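/- Let $b>0$, $p\in(0,1)$, $q=1-p$. Let $(X(t))_{t\ge 0}$ be a birth–death type branching process with death rate $pb$ and birth rate $qb$ and $X(0)=1$, that is, a continuous-time Markov chain on $\{0,1,2,\dots\}$ with càdlàg paths whose (honest) transition function satisfies the Kolmogorov forward equations of the $Q$-matrix with $q_{i,i-1}=ipb$, $q_{i,i}=-ib$, $q_{i,i+1}=iqb$ and all other entries $0$. Let $\tau=\inf\{t\ge 0: X(t)=0\}$ be the extinction time and let $Y(t)$ be the death number until time $t$, i.e. the number of $s\in(0,t]$ with $X(s)=X(s-)-1$. Then $$P(\tau<\infty)=\rho:=\min(1,p/q),$$ $Y(\tau)$ is finite whenever $\tau<\infty$, and the probability generating function of the total death number conditioned on extinction is $$E\big[v^{Y(\tau)}\,\big|\,\tau<\infty\big]=\rho^{-1}\beta(v),\qquad v\in[0,1],$$ where $$\beta(v)=\frac{1-\sqrt{1-4pqv}}{2q}=p\Big[v+\sum_{n=2}^{\infty}\frac{(2n-3)!!\,2^{n-1}(pq)^{n-1}}{n!}\,v^n\Big].$$ -/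

import Mathlib

open MeasureTheory ProbabilityTheory Filter Topology Set
open scoped NNReal ENNReal Nat

namespace MBP

/-- Admissible rates of a Markov branching process: `b j ≥ 0` for `j ≠ 1` and
`0 < -b 1 = ∑_{j ≠ 1} b j < ∞`. -/
structure IsBranchingRates (b : ℕ → ℝ) : Prop where
  nonneg : ∀ j, j ≠ 1 → 0 ≤ b j
  neg : 0 < -b 1
  hasSum : HasSum (fun j => if j = 1 then 0 else b j) (-b 1)

/-- The branching `Q`-matrix: `q i j = i * b (j - i + 1)` if `i ≥ 1` and `j ≥ i - 1`,
and `q i j = 0` otherwise. -/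
def qMatrix (b : ℕ → ℝ) (i j : ℕ) : ℝ :=
  if 1 ≤ i ∧ i ≤ j + 1 then (i : ℝ) * b (j + 1 - i) else 0

/-- `P t i j`, `t ≥ 0`, is an honest transition function on `ℕ` that satisfies the Kolmogorov
forward equation `p'_{ij}(t) = ∑_k p_{ik}(t) q_{kj}` of the branching `Q`-matrix with rates `b`
(a one-sided derivative at `t = 0`). Only finitely many terms of the sum are nonzero. -/
structure IsTransitionFunction (b : ℕ → ℝ) (P : ℝ≥0 → ℕ → ℕ → ℝ) : Prop where
  nonneg : ∀ t i j, 0 ≤ P t i j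
  hasSum_one : ∀ t i, HasSum (P t i) 1
  zero : ∀ i j, P 0 i j = if i = j then 1 else 0
  chapman_kolmogorov : ∀ s t i j, P (s + t) i j = ∑' k, P s i k * P t k j
  forward : ∀ (t : ℝ≥0) (i j : ℕ),
    HasDerivWithinAt (fun s : ℝ => P s.toNNReal i j) (∑' k, P t i k * qMatrix b k j)
      (Ici 0) (t : ℝ)

variable {Ω : Type*}

/-- The σ-algebra generated by `X r`, `r ≤ s`. -/
abbrev past (X : ℝ≥0 → Ω → ℕ) (s : ℝ≥0) : MeasurableSpace Ω :=
  ⨆ r : ℝ≥0, ⨆ _ : r ≤ s, MeasurableSpace.comap (X r) ⊤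

/-- `X` is a (regular) Markov branching process with rates `b`: a continuous-time Markov chain on
`ℕ` with càdlàg paths (for the discrete topology of `ℕ`, so finitely many jumps in bounded time),
whose transition function solves the forward equation of the branching `Q`-matrix. -/
structure IsMarkovBranchingProcess [MeasurableSpace Ω] (b : ℕ → ℝ) (X : ℝ≥0 → Ω → ℕ)
    (μ : Measure Ω) : Prop where
  rates : IsBranchingRates b
  measurable : ∀ t, Measurable (X t)
  right_continuous : ∀ ω t, ContinuousWithinAt (fun s => X s ω) (Ici t) t
  left_limits : ∀ ω t, ∃ l, Tendsto (fun s => X s ω) (𝓝[<] t) (𝓝 l)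
  markov : ∃ P : ℝ≥0 → ℕ → ℕ → ℝ, IsTransitionFunction b P ∧
    ∀ (s t : ℝ≥0) (j : ℕ), μ⟦X (s + t) ⁻¹' {j} | past X s⟧ =ᵐ[μ] fun ω => P t (X s ω) j

/-- The rates of the birth-death type branching process: each particle dies at rate `p * b` and
splits into two at rate `q * b` (where `p + q = 1`). -/
def birthDeathRates (p q b : ℝ) : ℕ → ℝ
  | 0 => p * b
  | 1 => -b
  | 2 => q * b
  | _ => 0

theorem isBranchingRates_birthDeathRates {p q b : ℝ} (hp : 0 ≤ p) (hq : 0 ≤ q) (hpq : p + q = 1)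
    (hb : 0 < b) : IsBranchingRates (birthDeathRates p q b) where
  nonneg j hj := by
    match j, hj with
    | 0, _ => exact mul_nonneg hp hb.le
    | 2, _ => exact mul_nonneg hq hb.le
    | (_ + 3), _ => exact le_rfl
  neg := by simpa [birthDeathRates] using hb
  hasSum := by
    have h := hasSum_sum_of_ne_finset_zero (L := SummationFilter.unconditional ℕ)
      (s := Finset.range 3)
      (f := fun j => if j = 1 then 0 else birthDeathRates p q b j) (by
        intro j hj
        match j, hj with
        | 0, h => simp at h
        | 1, h => simp at h
        | 2, h => simp at h
        | (_ + 3), _ => simp [birthDeathRates])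
    convert h using 1
    simp only [Finset.sum_range_succ, Finset.sum_range_zero, birthDeathRates]
    norm_num
    linear_combination (-b) * hpq

/-- The extinction time `τ = inf {t ≥ 0 : X t = 0}`, equal to `∞` if there is no such `t`. -/
noncomputable def extinctionTime (X : ℝ≥0 → Ω → ℕ) (ω : Ω) : ℝ≥0∞ :=
  ⨅ (t : ℝ≥0) (_ : X t ω = 0), (t : ℝ≥0∞)

/-- The death number until time `T ∈ [0, ∞]`: the number of times `0 < s ≤ T` at which the path
jumps down by one, `X (s-) = X s + 1`. -/
noncomputable def deathNumber (X : ℝ≥0 → Ω → ℕ) (T : ℝ≥0∞) (ω : Ω) : ℕ∞ :=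
  {s : ℝ≥0 | 0 < s ∧ (s : ℝ≥0∞) ≤ T ∧ ∀ᶠ r in 𝓝[<] s, X r ω = X s ω + 1}.encard

/-- `β(v) = (1 - √(1 - 4pqv)) / (2q)`. -/
noncomputable def beta (p q v : ℝ) : ℝ := (1 - √(1 - 4 * p * q * v)) / (2 * q)

end MBP

namespace MBP

/-! Let `φ(x) = p v - x + q x²`, whose smaller root is `β(v)`. At a state `i ≥ 1` the drift of `v ^
Y * x ^ X` is `i b v ^ Y x ^ (i - 1) φ(x)`, so `v ^ Y(t) * β(v) ^ X(t)` has constant mean `β(v)`. If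
`v < 1`, then `φ` is negative between `β(v)` and `1`. For `x` there, the part of the mean of `v ^
Y(t) * x ^ X(t)` carried by `X(t) ≠ 0` decays exponentially, and it dominates the same part with
`β(v)` in place of `x`. What remains is `E[v ^ Y(t); X(t) = 0] → β(v)`. As `0` is absorbing, this
limit is also `E[v ^ Y(τ); τ < ∞]`. Continuity in `v` gives `v = 1`, where `β(1) = min 1 (p / q)` is
the extinction probability; dividing by it conditions on extinction.

The drift is computed by discretization. The forward equation gives `P h i j = δ_ij + h q_ij +
O(h²)` with a constant uniform in `i` and polynomial in `j` (`abs_sub_le`), hence summable against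
`x ^ j` for `x < 1`. Over a grid of mesh `t / (n + 1)` the `n + 1` one-step errors add up to `O(1 /
n)`, and for each càdlàg path the down-steps seen on the grid are eventually exactly the deaths
(`eventually_deathNumber_eq`).

The power series comes from the Catalan generating function: `β(v) / (p v)` is the smaller root of
`c = 1 + (p q v) c²`. -/

/-! ### Catalan numbers and their generating function -/

theorem sum_antidiagonal_mul_le_sq {f : ℕ → ℝ} (hf : ∀ n, 0 ≤ f n) (N : ℕ) :
    ∑ n ∈ Finset.range N, ∑ ij ∈ Finset.HasAntidiagonal.antidiagonal n, f ij.1 * f ij.2 ≤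
      (∑ n ∈ Finset.range N, f n) ^ 2 := by
  have h1 := Finset.sum_fiberwise_of_maps_to (t := Finset.range N)
    (s := (Finset.range N ×ˢ Finset.range N).filter fun ij => ij.1 + ij.2 < N)
    (g := fun ij => ij.1 + ij.2) (by
      intro ij hij
      exact Finset.mem_range.2 (Finset.mem_filter.1 hij).2) (fun ij => f ij.1 * f ij.2)
  rw [sq, Finset.sum_mul_sum, ← Finset.sum_product']
  refine le_of_eq_of_le ?_ (Finset.sum_le_sum_of_subset_of_nonneg (Finset.filter_subset
    (fun ij => ij.1 + ij.2 < N) _) fun ij _ _ => mul_nonneg (hf _) (hf _))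
  rw [← h1]
  refine Finset.sum_congr rfl fun n hn => Finset.sum_congr ?_ fun _ _ => rfl
  ext ij
  simp only [Finset.HasAntidiagonal.mem_antidiagonal, Finset.mem_filter, Finset.mem_product,
    Finset.mem_range] at hn ⊢
  omega

/-- Convolution recursion: the partial sums satisfy `S (N + 1) ≤ 1 + x * S N ^ 2`, and `s ↦ 1 + x
s²` is increasing on `s ≥ 0` and fixes `c`. This gives convergence, even at the boundary of the
disc, without any growth estimate for `catalan`. -/
theorem sum_catalan_mul_pow_le {x c : ℝ} (hx : 0 ≤ x) (hc0 : 0 ≤ c) (hc : 1 + x * c ^ 2 = c)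
    (N : ℕ) : ∑ n ∈ Finset.range N, (catalan n : ℝ) * x ^ n ≤ c := by
  induction N with
  | zero => simpa
  | succ N ih =>
    have h0 : ∀ n, 0 ≤ (catalan n : ℝ) * x ^ n := fun n => by positivity
    have h1 := sum_antidiagonal_mul_le_sq h0 N
    have h2 : ∑ n ∈ Finset.range N, (catalan (n + 1) : ℝ) * x ^ (n + 1) =
        x * ∑ n ∈ Finset.range N, ∑ ij ∈ Finset.HasAntidiagonal.antidiagonal n,
          ((catalan ij.1 : ℝ) * x ^ ij.1) * ((catalan ij.2 : ℝ) * x ^ ij.2) := by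
      rw [Finset.mul_sum]
      refine Finset.sum_congr rfl fun n _ => ?_
      rw [catalan_succ', Nat.cast_sum, Finset.sum_mul, Finset.mul_sum]
      refine Finset.sum_congr rfl fun ij hij => ?_
      rw [← Finset.HasAntidiagonal.mem_antidiagonal.1 hij]
      push_cast
      ring
    rw [Finset.sum_range_succ', h2]
    have h3 : (∑ n ∈ Finset.range N, (catalan n : ℝ) * x ^ n) ^ 2 ≤ c ^ 2 :=
      pow_le_pow_left₀ (Finset.sum_nonneg fun n _ => h0 n) ih 2
    have h4 := mul_le_mul_of_nonneg_left (h1.trans h3) hx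
    simp only [catalan_zero, pow_zero, Nat.cast_one, mul_one]
    linarith

/-- The generating function of the Catalan numbers is the smaller root of `c = 1 + x c²`. -/
theorem hasSum_catalan_mul_pow {x c : ℝ} (hx : 0 ≤ x) (hc0 : 0 ≤ c) (hc : 1 + x * c ^ 2 = c)
    (hxc : 2 * x * c ≤ 1) : HasSum (fun n => (catalan n : ℝ) * x ^ n) c := by
  have h0 : ∀ n, 0 ≤ (catalan n : ℝ) * x ^ n := fun n => by positivity
  have hs : Summable fun n => (catalan n : ℝ) * x ^ n :=
    summable_of_sum_range_le h0 (sum_catalan_mul_pow_le hx hc0 hc)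
  have hle : ∑' n, (catalan n : ℝ) * x ^ n ≤ c :=
    Real.tsum_le_of_sum_range_le h0 (sum_catalan_mul_pow_le hx hc0 hc)
  have heq : ∑' n, (catalan n : ℝ) * x ^ n = 1 + x * (∑' n, (catalan n : ℝ) * x ^ n) ^ 2 := by
    rw [sq, tsum_mul_tsum_eq_tsum_sum_antidiagonal_of_summable_norm hs.norm hs.norm,
      ← tsum_mul_left, hs.tsum_eq_zero_add]
    simp only [catalan_zero, pow_zero, Nat.cast_one, mul_one]
    congr 2
    funext n
    rw [catalan_succ', Nat.cast_sum, Finset.sum_mul, Finset.mul_sum]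
    refine Finset.sum_congr rfl fun ij hij => ?_
    rw [← Finset.HasAntidiagonal.mem_antidiagonal.1 hij]
    push_cast
    ring
  set C := ∑' n, (catalan n : ℝ) * x ^ n
  have hC : C = c := by
    rcases hle.eq_or_lt with h | h
    · exact h
    · exfalso
      -- Both are roots of the same quadratic. If `C < c` and `x > 0`, then `x * (c + C) < 2 * x * c
      -- ≤ 1`, so neither factor vanishes.
      have h5 : (c - C) * (1 - x * (c + C)) = 0 := by linear_combination -hc - heq
      rcases mul_eq_zero.1 h5 with h6 | h6
      · linarith
      · rcases hx.eq_or_lt with h7 | h7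
        · rw [← h7] at h6
          norm_num at h6
        · nlinarith
  rw [← hC]
  exact hs.hasSum

theorem catalan_succ_eq_doubleFactorial (m : ℕ) :
    (catalan (m + 1) : ℝ) = ((2 * m + 1)‼ : ℝ) * 2 ^ (m + 1) / ((m + 2)! : ℝ) := by
  have h1 : (m + 2) * catalan (m + 1) = Nat.centralBinom (m + 1) :=
    succ_mul_catalan_eq_centralBinom (m + 1)
  have h2 := Nat.centralBinom_eq_two_mul_choose (m + 1)
  have h3 := Nat.choose_mul_factorial_mul_factorial (n := 2 * (m + 1)) (k := m + 1) (by omega)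
  have h6 : (2 * (m + 1))! = 2 ^ (m + 1) * (m + 1)! * (2 * m + 1)‼ := by
    rw [← Nat.doubleFactorial_two_mul]
    exact Nat.factorial_eq_mul_doubleFactorial (2 * m + 1)
  rw [← h2, ← h1, show 2 * (m + 1) - (m + 1) = m + 1 by omega, h6] at h3
  have h4 : (m + 2) ! = (m + 2) * (m + 1)! := Nat.factorial_succ (m + 1)
  have h5 : (catalan (m + 1)) * (m + 2)! = (2 * m + 1)‼ * 2 ^ (m + 1) := by
    apply Nat.eq_of_mul_eq_mul_right (Nat.factorial_pos (m + 1))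
    rw [h4]
    linarith
  rw [eq_div_iff (by positivity)]
  exact_mod_cast h5

/-! ### The function `β`: quadratic equation, bounds, power series -/

theorem four_mul_mul_mul_le_one {p q v : ℝ} (hpq : p + q = 1) (hpq0 : 0 ≤ p * q) (hv : v ≤ 1) :
    4 * p * q * v ≤ 1 := by
  have h1 : 4 * (p * q) ≤ 1 := by nlinarith [sq_nonneg (p - q)]
  nlinarith

theorem beta_root {p q v : ℝ} (hp : 0 < p) (hq : 0 < q) (hpq : p + q = 1) (hv : v ≤ 1) :
    p * v - beta p q v + q * beta p q v ^ 2 = 0 := by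
  have h1 := four_mul_mul_mul_le_one hpq (by positivity) hv
  have h2 := Real.sq_sqrt (sub_nonneg.2 h1)
  rw [beta]
  set R := √(1 - 4 * p * q * v)
  field_simp
  linear_combination h2

theorem two_mul_beta {p q v : ℝ} (hq : 0 < q) :
    2 * q * beta p q v = 1 - √(1 - 4 * p * q * v) := by
  rw [beta]
  field_simp

theorem beta_nonneg {p q v : ℝ} (hp : 0 < p) (hq : 0 < q) (hv : 0 ≤ v) :
    0 ≤ beta p q v := by
  rw [beta]
  have h1 : √(1 - 4 * p * q * v) ≤ 1 := by
    have : 0 ≤ 4 * p * q * v := by positivity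
    exact Real.sqrt_le_iff.2 ⟨zero_le_one, by linarith⟩
  have := sub_nonneg.2 h1
  positivity

theorem beta_one {p q : ℝ} (hq : 0 < q) (hpq : p + q = 1) :
    beta p q 1 = min 1 (p / q) := by
  have h1 : 1 - 4 * p * q * 1 = (p - q) ^ 2 := by
    linear_combination (-(p + q) - 1) * hpq
  rw [beta, h1, Real.sqrt_sq_eq_abs]
  rcases le_total p q with h | h
  · rw [abs_of_nonpos (by linarith), min_eq_right ((div_le_one hq).2 h)]
    field_simp
    linarith
  · rw [abs_of_nonneg (by linarith), min_eq_left ((one_le_div hq).2 h)]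
    field_simp
    linarith

theorem beta_lt_one {p q v : ℝ} (hp : 0 < p) (hq : 0 < q) (hpq : p + q = 1) (hv : v < 1) :
    beta p q v < 1 := by
  refine lt_of_lt_of_le ?_ ((beta_one hq hpq).trans_le (min_le_left _ _))
  have h1 := four_mul_mul_mul_le_one hpq (by positivity) le_rfl
  rw [beta, beta]
  have h2 : √(1 - 4 * p * q * 1) < √(1 - 4 * p * q * v) := by
    apply Real.sqrt_lt_sqrt (by linarith)
    have : 0 < p * q := by positivity
    nlinarith
  gcongr

theorem continuous_beta (p q : ℝ) : Continuous (beta p q) := by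
  unfold beta
  fun_prop

theorem exists_hasSum_beta {p q v : ℝ} (hp : 0 < p) (hq : 0 < q) (hpq : p + q = 1) (hv0 : 0 ≤ v)
    (hv1 : v ≤ 1) : ∃ S : ℝ,
      HasSum (fun n : ℕ => ((2 * (n + 2) - 3)‼ : ℝ) * 2 ^ (n + 2 - 1) *
        (p * q) ^ (n + 2 - 1) / ((n + 2)! : ℝ) * v ^ (n + 2)) S ∧
      beta p q v = p * (v + S) := by
  rcases hv0.eq_or_lt with rfl | hv
  -- The case `v = 0` is separate because the Catalan argument divides by `p * v`.
  · exact ⟨0, by simp, by simp [beta]⟩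
  have hroot := beta_root hp hq hpq hv1
  set β := beta p q v with hβ
  have h1 : HasSum (fun n => (catalan n : ℝ) * (p * q * v) ^ n) (β / (p * v)) := by
    apply hasSum_catalan_mul_pow (by positivity) (div_nonneg (beta_nonneg hp hq hv0) (by positivity))
    · field_simp
      linear_combination hroot
    · have : 2 * (p * q * v) * (β / (p * v)) = 2 * q * β := by field_simp
      rw [this, hβ, two_mul_beta hq]
      linarith [Real.sqrt_nonneg (1 - 4 * p * q * v)]
  have h2 := ((hasSum_nat_add_iff' 1).2 h1).mul_left v
  refine ⟨v * (β / (p * v) - ∑ i ∈ Finset.range 1, (catalan i : ℝ) * (p * q * v) ^ i), ?_, ?_⟩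
  · refine Eq.subst (motive := fun f => HasSum f _) (funext fun n => ?_) h2
    rw [catalan_succ_eq_doubleFactorial, show 2 * (n + 2) - 3 = 2 * n + 1 by omega,
      show n + 2 - 1 = n + 1 by omega, mul_pow _ v]
    ring
  · simp
    field_simp
    ring

end MBP

/-! ### Short-time expansion of the transition function -/

namespace MBP

theorem abs_birthDeathRates_le {p q b : ℝ} (hp : 0 ≤ p) (hq : 0 ≤ q) (hpq : p + q = 1)
    (hb : 0 < b) (j : ℕ) : |birthDeathRates p q b j| ≤ b := by
  match j with
  | 0 => simp only [birthDeathRates]; rw [abs_of_nonneg (by positivity)]; nlinarith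
  | 1 => simp only [birthDeathRates]; rw [abs_neg, abs_of_pos hb]
  | 2 => simp only [birthDeathRates]; rw [abs_of_nonneg (by positivity)]; nlinarith
  | (_ + 3) => simp only [birthDeathRates]; simpa using hb.le

theorem abs_qMatrix_le {r : ℕ → ℝ} {B : ℝ} (hB : ∀ j, |r j| ≤ B) (i j : ℕ) :
    |qMatrix r i j| ≤ i * B := by
  have hB0 : 0 ≤ B := (abs_nonneg _).trans (hB 0)
  unfold qMatrix
  split_ifs
  · rw [abs_mul, Nat.abs_cast]
    exact mul_le_mul_of_nonneg_left (hB _) (Nat.cast_nonneg _)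
  · rw [abs_zero]
    positivity

theorem qMatrix_eq_zero {r : ℕ → ℝ} {i j : ℕ} (h : j + 2 ≤ i) : qMatrix r i j = 0 := by
  rw [qMatrix, if_neg (by omega)]

theorem tsum_mul_qMatrix (r f : ℕ → ℝ) (j : ℕ) :
    ∑' k, f k * qMatrix r k j = ∑ k ∈ Finset.range (j + 2), f k * qMatrix r k j := by
  refine tsum_eq_sum fun k hk => ?_
  rw [qMatrix_eq_zero (by simpa using hk), mul_zero]

/-- Column `j` of the `Q`-matrix vanishes below row `j + 1`, so it has at most `j + 2` nonzero
entries, each at most `(j + 2) * B`. The bound involves no initial state, which is what makes the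
later expansion uniform in `i`. -/
theorem abs_sum_mul_qMatrix_le {r f : ℕ → ℝ} {B M : ℝ} (hB : ∀ j, |r j| ≤ B) (j : ℕ)
    (hf : ∀ k < j + 2, |f k| ≤ M) :
    |∑ k ∈ Finset.range (j + 2), f k * qMatrix r k j| ≤ M * B * (j + 2) ^ 2 := by
  have hB0 : 0 ≤ B := (abs_nonneg _).trans (hB 0)
  have hM : 0 ≤ M := (abs_nonneg _).trans (hf 0 (by omega))
  calc |∑ k ∈ Finset.range (j + 2), f k * qMatrix r k j|
      ≤ ∑ k ∈ Finset.range (j + 2), |f k * qMatrix r k j| := Finset.abs_sum_le_sum_abs _ _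
    _ ≤ ∑ _k ∈ Finset.range (j + 2), M * ((j + 2) * B) := by
        refine Finset.sum_le_sum fun k hk => ?_
        have hk' := Finset.mem_range.1 hk
        rw [abs_mul]
        refine mul_le_mul (hf k hk') ((abs_qMatrix_le hB k j).trans ?_) (abs_nonneg _) hM
        gcongr
        exact_mod_cast hk'.le
    _ = M * B * (j + 2) ^ 2 := by
        rw [Finset.sum_const, Finset.card_range, nsmul_eq_mul]
        push_cast
        ring

namespace IsTransitionFunction

variable {r : ℕ → ℝ} {P : ℝ≥0 → ℕ → ℕ → ℝ} {B : ℝ}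

theorem le_one (hP : IsTransitionFunction r P) (t : ℝ≥0) (i j : ℕ) : P t i j ≤ 1 :=
  le_hasSum (hP.hasSum_one t i) j fun k _ => hP.nonneg t i k

theorem abs_le_one (hP : IsTransitionFunction r P) (t : ℝ≥0) (i j : ℕ) : |P t i j| ≤ 1 := by
  rw [abs_of_nonneg (hP.nonneg t i j)]
  exact hP.le_one t i j

theorem hasDerivWithinAt_sum (hP : IsTransitionFunction r P) (i j : ℕ) {s : ℝ} (hs : 0 ≤ s) :
    HasDerivWithinAt (fun s : ℝ => P s.toNNReal i j)
      (∑ k ∈ Finset.range (j + 2), P s.toNNReal i k * qMatrix r k j) (Ici 0) s := by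
  have h := hP.forward s.toNNReal i j
  rwa [tsum_mul_qMatrix, Real.coe_toNNReal s hs] at h

/-- Second order expansion of the transition function at time `0`, uniform in the initial state. -/
theorem abs_sub_le (hP : IsTransitionFunction r P) (hB : ∀ j, |r j| ≤ B) (h : ℝ≥0) (i j : ℕ) :
    |P h i j - ((if i = j then 1 else 0) + h * qMatrix r i j)| ≤
      B ^ 2 * (j + 4) ^ 4 * (h : ℝ) ^ 2 := by
  have hB0 : 0 ≤ B := (abs_nonneg _).trans (hB 0)
  set L : ℕ → ℝ → ℝ := fun j s =>
    ∑ k ∈ Finset.range (j + 2), P s.toNNReal i k * qMatrix r k j with hL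
  set K : ℝ := B ^ 2 * (j + 4) ^ 4 with hK
  have hLb : ∀ k s, |L k s| ≤ 1 * B * (k + 2) ^ 2 := fun k s =>
    abs_sum_mul_qMatrix_le hB k fun l _ => hP.abs_le_one _ _ _
  -- `L j` is the derivative of `P · i j`. Each forward sum is finite, so the equation can be
  -- differentiated once more; the second derivative is bounded by `K`, and the mean value
  -- inequality is then applied twice.
  have hLd : ∀ s ∈ Ici (0 : ℝ), HasDerivWithinAt (L j)
      (∑ k ∈ Finset.range (j + 2), L k s * qMatrix r k j) (Ici 0) s := fun s hs =>
    HasDerivWithinAt.fun_sum fun k _ => (hP.hasDerivWithinAt_sum i k hs).mul_const _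
  have hLdb : ∀ s ∈ Ici (0 : ℝ), ‖∑ k ∈ Finset.range (j + 2), L k s * qMatrix r k j‖ ≤ K := by
    intro s _
    have h1 : ∀ k < j + 2, |L k s| ≤ B * (j + 4) ^ 2 := by
      intro k hk
      have hk' : (k : ℝ) + 2 ≤ j + 4 := by
        have : (k : ℝ) ≤ j + 2 := by exact_mod_cast hk.le
        linarith
      refine (hLb k s).trans ?_
      rw [one_mul]
      gcongr
    rw [Real.norm_eq_abs]
    refine (abs_sum_mul_qMatrix_le hB j h1).trans ?_
    have : B * (j + 4 : ℝ) ^ 2 * B * (j + 2) ^ 2 ≤ B * (j + 4 : ℝ) ^ 2 * B * (j + 4) ^ 2 := by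
      gcongr
      norm_num
    rw [hK]
    linarith
  have hP0 : ∀ k, P (0 : ℝ).toNNReal i k = if i = k then 1 else 0 := fun k => by
    rw [Real.toNNReal_zero, hP.zero]
  have hL0 : L j 0 = qMatrix r i j := by
    simp only [hL, hP0, ite_mul, one_mul, zero_mul, Finset.sum_ite_eq, Finset.mem_range]
    split_ifs with hij
    · rfl
    · exact (qMatrix_eq_zero (by omega)).symm
  have hLs : ∀ s ∈ Ici (0 : ℝ), |L j s - L j 0| ≤ K * s := by
    intro s hs
    have := (convex_Ici (0 : ℝ)).norm_image_sub_le_of_norm_hasDerivWithin_le hLd hLdb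
      (mem_Ici.2 le_rfl) hs
    simpa [abs_of_nonneg (show (0 : ℝ) ≤ s from hs)] using this
  have hg : ∀ s ∈ Icc (0 : ℝ) h, HasDerivWithinAt (fun s => P s.toNNReal i j - s * L j 0)
      (L j s - 1 * L j 0) (Icc 0 h) s := fun s hs =>
    ((hP.hasDerivWithinAt_sum i j hs.1).mono Icc_subset_Ici_self).sub
      ((hasDerivWithinAt_id s _).mul_const _)
  have hgb : ∀ s ∈ Icc (0 : ℝ) h, ‖L j s - 1 * L j 0‖ ≤ K * h := by
    intro s hs
    rw [one_mul]
    refine (hLs s hs.1).trans ?_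
    gcongr
    exact hs.2
  have := (convex_Icc (0 : ℝ) h).norm_image_sub_le_of_norm_hasDerivWithin_le hg hgb
    (left_mem_Icc.2 h.2) (right_mem_Icc.2 h.2)
  rw [hP0, hL0, Real.toNNReal_coe] at this
  simp only [sub_zero, zero_mul, Real.norm_eq_abs, NNReal.abs_eq] at this
  calc _ = |P h i j - h * qMatrix r i j - (if i = j then 1 else 0)| := by congr 1; ring
    _ ≤ _ := this
    _ = _ := by ring

theorem summable_mul (hP : IsTransitionFunction r P) (h : ℝ≥0) (i : ℕ) {g u : ℕ → ℝ}
    (hg : ∀ j, |g j| ≤ u j) (hu : Summable u) : Summable fun j => P h i j * g j := by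
  refine Summable.of_norm_bounded hu fun j => ?_
  rw [norm_mul, Real.norm_eq_abs, Real.norm_eq_abs]
  have := mul_le_mul (hP.abs_le_one h i j) (hg j) (abs_nonneg _) zero_le_one
  linarith

/-- First order expansion of the semigroup on functions of exponential decay, uniform in the
initial state. -/
theorem exists_abs_tsum_sub_le (hP : IsTransitionFunction r P) (hB : ∀ j, |r j| ≤ B)
    {ρ : ℝ} (hρ0 : 0 ≤ ρ) (hρ1 : ρ < 1) :
    ∃ C : ℝ, 0 ≤ C ∧ ∀ (h : ℝ≥0) (i : ℕ) (g : ℕ → ℝ) (a : ℝ), (∀ j, |g j| ≤ ρ ^ j) →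
      HasSum (fun j => ((if i = j then 1 else 0) + h * qMatrix r i j) * g j) a →
      |∑' j, P h i j * g j - a| ≤ C * (h : ℝ) ^ 2 := by
  have hs : Summable fun j : ℕ => B ^ 2 * (j + 4 : ℝ) ^ 4 * ρ ^ j := by
    have h1 : Summable fun j : ℕ => (j : ℝ) ^ 4 * ρ ^ j :=
      summable_pow_mul_geometric_of_norm_lt_one 4 (by rwa [Real.norm_of_nonneg hρ0])
    have h2 : Summable fun j : ℕ => ρ ^ j := summable_geometric_of_lt_one hρ0 hρ1
    have h3 := (((h1.add h2).mul_left (5 ^ 4)).mul_left (B ^ 2))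
    refine Summable.of_nonneg_of_le (fun j => by positivity) (fun j => ?_) h3
    rw [mul_assoc]
    refine mul_le_mul_of_nonneg_left ?_ (sq_nonneg B)
    rw [← add_one_mul, ← mul_assoc]
    refine mul_le_mul_of_nonneg_right ?_ (by positivity)
    rcases Nat.eq_zero_or_pos j with rfl | hj
    · norm_num
    · have : (j : ℝ) + 4 ≤ 5 * j := by
        have : (1 : ℝ) ≤ j := by exact_mod_cast hj
        linarith
      calc (j + 4 : ℝ) ^ 4 ≤ (5 * j) ^ 4 := by gcongr
        _ ≤ 5 ^ 4 * ((j : ℝ) ^ 4 + 1) := by rw [mul_pow]; gcongr; linarith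
  -- The polynomial constants of `abs_sub_le`, summed against the geometric bound on `g`; this is
  -- where `ρ < 1` is needed.
  refine ⟨∑' j : ℕ, B ^ 2 * (j + 4 : ℝ) ^ 4 * ρ ^ j, tsum_nonneg fun j => by positivity, ?_⟩
  intro h i g a hg ha
  have h1 := (hP.summable_mul h i hg (summable_geometric_of_lt_one hρ0 hρ1)).hasSum.sub ha
  rw [← h1.tsum_eq, ← tsum_mul_right, ← Real.norm_eq_abs]
  refine tsum_of_norm_bounded (hs.mul_right _).hasSum fun j => ?_
  rw [← sub_mul, norm_mul, Real.norm_eq_abs, Real.norm_eq_abs]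
  calc _ ≤ B ^ 2 * (j + 4) ^ 4 * (h : ℝ) ^ 2 * ρ ^ j :=
        mul_le_mul (hP.abs_sub_le hB h i j) (hg j) (abs_nonneg _) (by positivity)
    _ = _ := by ring

/-- The state `0` is absorbing. -/
theorem apply_zero_zero (hP : IsTransitionFunction r P) (hB : ∀ j, |r j| ≤ B) (t : ℝ≥0) :
    P t 0 0 = 1 := by
  refine le_antisymm (hP.le_one t 0 0) ?_
  set K : ℝ := B ^ 2 * 4 ^ 4
  -- Since `q 0 0 = 0`, leaving `0` within time `h` has probability `O(h²)`. Over `n + 1` steps of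
  -- length `t / (n + 1)` the total loss is `O(1 / n)`.
  have h1 : ∀ h : ℝ≥0, 1 - K * (h : ℝ) ^ 2 ≤ P h 0 0 := by
    intro h
    have := (abs_le.1 (hP.abs_sub_le hB h 0 0)).1
    simp [qMatrix] at this
    simp only [K]
    linarith
  have h2 : ∀ (h : ℝ≥0) (n : ℕ), 1 - n * (K * (h : ℝ) ^ 2) ≤ P (n * h) 0 0 := by
    intro h n
    induction n with
    | zero => simp [hP.zero]
    | succ n ih =>
      have hs : Summable fun k => P (n * h) 0 k * P h k 0 :=
        Summable.of_nonneg_of_le (fun k => mul_nonneg (hP.nonneg _ _ _) (hP.nonneg _ _ _))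
          (fun k => mul_le_of_le_one_right (hP.nonneg _ _ _) (hP.le_one _ _ _))
          (hP.hasSum_one _ _).summable
      have h3 := hs.le_tsum 0 fun k _ => mul_nonneg (hP.nonneg _ _ _) (hP.nonneg _ _ _)
      rw [← hP.chapman_kolmogorov] at h3
      have h4 := h1 h
      have h5 := hP.le_one (n * h) 0 0
      have h6 := hP.le_one h 0 0
      push_cast
      rw [add_mul, one_mul, add_mul, one_mul]
      nlinarith
  have h3 : ∀ n : ℕ, 1 - K * (t : ℝ) ^ 2 * (1 / ((n : ℝ) + 1)) ≤ P t 0 0 := by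
    intro n
    have h4 := h2 (t / (n + 1)) (n + 1)
    have h5 : ((n + 1 : ℕ) : ℝ≥0) * (t / (n + 1)) = t := by
      push_cast
      field_simp
    rw [h5] at h4
    refine le_of_eq_of_le ?_ h4
    push_cast
    field_simp
  have h4 : Tendsto (fun n : ℕ => 1 - K * (t : ℝ) ^ 2 * (1 / ((n : ℝ) + 1))) atTop (𝓝 1) := by
    simpa using (tendsto_one_div_add_atTop_nhds_zero_nat (𝕜 := ℝ)).const_mul (K * (t : ℝ) ^ 2)
      |>.const_sub 1
  exact le_of_tendsto' h4 h3

end IsTransitionFunction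

theorem hasSum_ite_add_qMatrix_zero (r : ℕ → ℝ) (h : ℝ) (g : ℕ → ℝ) :
    HasSum (fun j => ((if 0 = j then 1 else 0) + h * qMatrix r 0 j) * g j) (g 0) := by
  convert hasSum_single 0 ?_ using 1
  · simp [qMatrix]
  · intro j hj
    simp [qMatrix, hj.symm]

theorem hasSum_ite_add_qMatrix_succ (p q b h : ℝ) (g : ℕ → ℝ) (i : ℕ) :
    HasSum (fun j => ((if i + 1 = j then 1 else 0) +
        h * qMatrix (birthDeathRates p q b) (i + 1) j) * g j)
      (g (i + 1) + h * (i + 1) * b * (p * g i - g (i + 1) + q * g (i + 2))) := by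
  have h1 := hasSum_sum_of_ne_finset_zero (L := SummationFilter.unconditional ℕ)
    (s := {i, i + 1, i + 2}) (f := fun j => ((if i + 1 = j then 1 else 0) +
        h * qMatrix (birthDeathRates p q b) (i + 1) j) * g j) (by
      intro j hj
      simp only [Finset.mem_insert, Finset.mem_singleton, not_or] at hj
      rw [if_neg (by omega), zero_add, qMatrix]
      split_ifs with h2
      · obtain ⟨m, rfl⟩ : ∃ m, j = i + 3 + m := ⟨j - (i + 3), by omega⟩
        rw [show i + 3 + m + 1 - (i + 1) = m + 3 by omega]
        simp [birthDeathRates]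
      · simp)
  convert h1 using 1
  rw [Finset.sum_insert (by simp), Finset.sum_insert (by simp), Finset.sum_singleton]
  simp only [qMatrix, show i + 1 ≤ i + 1 + 1 by omega, show i + 1 ≤ i + 2 + 1 by omega,
    show i + 1 - (i + 1) = 0 by omega, show i + 1 + 1 - (i + 1) = 1 by omega,
    show i + 2 + 1 - (i + 1) = 2 by omega, birthDeathRates]
  simp
  ring

end MBP

/-! ### Deaths along a path and their count on a fine grid -/

namespace MBP

/-- The positive times at which the path `x` jumps down by one. -/
def deathTimes (x : ℝ≥0 → ℕ) : Set ℝ≥0 := {s | 0 < s ∧ ∀ᶠ r in 𝓝[<] s, x r = x s + 1}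

theorem mem_deathTimes_iff {x : ℝ≥0 → ℕ} {a s : ℝ≥0} {c : ℕ} (has : a < s)
    (hc : ∀ r, a ≤ r → r < s → x r = c) : s ∈ deathTimes x ↔ c = x s + 1 := by
  have h1 : ∀ᶠ r in 𝓝[<] s, x r = c := by
    filter_upwards [Ico_mem_nhdsLT has] with r hr using hc r hr.1 hr.2
  constructor
  · rintro ⟨-, h2⟩
    have : (𝓝[<] s).NeBot := nhdsLT_neBot_of_exists_lt ⟨a, has⟩
    obtain ⟨r, hr1, hr2⟩ := (h1.and h2).exists
    rw [← hr1, hr2]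
  · intro h2
    exact ⟨(zero_le (a := a)).trans_lt has, h1.mono fun r hr => by rw [hr, h2]⟩

/-- On `[a, b]` the path can jump only at `u`, which may lie outside the interval. Comparing the
endpoint values then decides whether that jump is a death. -/
theorem encard_deathTimes_inter_Ioc {x : ℝ≥0 → ℕ} {a b u : ℝ≥0} {l : ℕ} (hab : a < b)
    (hl : ∀ r ∈ Icc a b, r < u → x r = l) (hu : ∀ r ∈ Icc a b, u ≤ r → x r = x u) :
    (deathTimes x ∩ Ioc a b).encard = if x a = x b + 1 then 1 else 0 := by
  have hconst : ∀ c, (∀ r ∈ Icc a b, x r = c) →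
      (deathTimes x ∩ Ioc a b).encard = if x a = x b + 1 then 1 else 0 := by
    intro c hc
    rw [hc a ⟨le_rfl, hab.le⟩, hc b ⟨hab.le, le_rfl⟩, if_neg (by omega), encard_eq_zero,
      eq_empty_iff_forall_notMem]
    rintro s ⟨hs, hs1, hs2⟩
    rw [mem_deathTimes_iff hs1 fun r h1 h2 => hc r ⟨h1, h2.le.trans hs2⟩,
      hc s ⟨hs1.le, hs2⟩] at hs
    omega
  rcases le_or_gt u a with hua | hua
  · exact hconst (x u) fun r hr => hu r hr (hua.trans hr.1)
  rcases lt_or_ge b u with hbu | hbu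
  · exact hconst l fun r hr => hl r hr (hr.2.trans_lt hbu)
  have hsub : ∀ s ∈ deathTimes x ∩ Ioc a b, s = u := by
    rintro s ⟨hs, hs1, hs2⟩
    rcases lt_trichotomy s u with h | h | h
    · rw [mem_deathTimes_iff hs1 fun r h1 h2 => hl r ⟨h1, h2.le.trans hs2⟩ (h2.trans h),
        hl s ⟨hs1.le, hs2⟩ h] at hs
      omega
    · exact h
    · rw [mem_deathTimes_iff h fun r h1 h2 => hu r ⟨hua.le.trans h1, h2.le.trans hs2⟩ h1,
        hu s ⟨hs1.le, hs2⟩ h.le] at hs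
      omega
  have hmem : u ∈ deathTimes x ↔ l = x u + 1 :=
    mem_deathTimes_iff hua fun r h1 h2 => hl r ⟨h1, h2.le.trans hbu⟩ h2
  rw [hl a ⟨le_rfl, hab.le⟩ hua, hu b ⟨hab.le, le_rfl⟩ hbu]
  split_ifs with h
  · rw [encard_eq_one]
    exact ⟨u, Subset.antisymm hsub (singleton_subset_iff.2 ⟨hmem.2 h, hua, hbu⟩)⟩
  · rw [encard_eq_zero, eq_empty_iff_forall_notMem]
    intro s hs
    have := hsub s hs
    subst this
    exact h (hmem.1 hs.1)

/-- In a discrete space, having a limit means being eventually constant. -/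
theorem exists_ball_const {x : ℝ≥0 → ℕ} (hr : ∀ t, ContinuousWithinAt x (Ici t) t)
    (hl : ∀ t, ∃ l, Tendsto x (𝓝[<] t) (𝓝 l)) (u : ℝ≥0) :
    ∃ ε > 0, ∃ l, ∀ r ∈ Metric.ball u ε, (r < u → x r = l) ∧ (u ≤ r → x r = x u) := by
  obtain ⟨l, h1⟩ := hl u
  have h2 := hr u
  rw [ContinuousWithinAt, nhds_discrete, tendsto_pure, eventually_nhdsWithin_iff] at h2
  rw [nhds_discrete, tendsto_pure, eventually_nhdsWithin_iff] at h1
  obtain ⟨ε, hε, h3⟩ := Metric.eventually_nhds_iff_ball.1 (h1.and h2)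
  exact ⟨ε, hε, l, h3⟩

/-- Down-steps of the path `x` along the grid of mesh `h`, up to the `n`-th grid point. -/
def gridDeaths (x : ℝ≥0 → ℕ) (h : ℝ≥0) (n : ℕ) : ℕ :=
  ∑ k ∈ Finset.range n, if x (k * h) = x ((k + 1 : ℕ) * h) + 1 then 1 else 0

theorem exists_encard_deathTimes_eq_gridDeaths {x : ℝ≥0 → ℕ}
    (hr : ∀ t, ContinuousWithinAt x (Ici t) t) (hl : ∀ t, ∃ l, Tendsto x (𝓝[<] t) (𝓝 l))
    (t : ℝ≥0) : ∃ δ > (0 : ℝ), ∀ (h : ℝ≥0) (n : ℕ), 0 < h → (h : ℝ) < δ → n * h ≤ t →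
      (deathTimes x ∩ Ioc 0 (n * h)).encard = gridDeaths x h n := by
  choose ε hε l hb using exists_ball_const hr hl
  -- Below the Lebesgue number of the cover by these balls, each grid cell lies in a single ball and
  -- so contains at most one jump.
  obtain ⟨δ, hδ, hball⟩ := lebesgue_number_lemma_of_metric (isCompact_Icc (a := (0 : ℝ≥0)) (b := t))
    (c := fun u => Metric.ball u (ε u)) (fun _ => Metric.isOpen_ball)
    (fun u _ => mem_iUnion.2 ⟨u, Metric.mem_ball_self (hε u)⟩)
  refine ⟨δ, hδ, fun h n hh hhδ => ?_⟩
  induction n with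
  | zero => simp [gridDeaths]
  | succ n ih =>
    intro hn
    have hstep : ((n + 1 : ℕ) : ℝ≥0) * h = n * h + h := by push_cast; ring
    have hlt : (n : ℝ≥0) * h < (n + 1 : ℕ) * h := by
      rw [hstep]
      exact lt_add_of_pos_right _ hh
    obtain ⟨u, hu⟩ := hball (n * h) ⟨zero_le, hlt.le.trans hn⟩
    have hsub : ∀ r ∈ Icc ((n : ℝ≥0) * h) ((n + 1 : ℕ) * h), r ∈ Metric.ball u (ε u) := by
      intro r hr
      refine hu ?_
      rw [Metric.mem_ball, NNReal.dist_eq, abs_of_nonneg (sub_nonneg.2 (NNReal.coe_le_coe.2 hr.1))]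
      have h1 := NNReal.coe_le_coe.2 hr.2
      rw [hstep, NNReal.coe_add] at h1
      linarith
    have h1 := encard_deathTimes_inter_Ioc hlt (fun r hr => (hb u r (hsub r hr)).1)
      (fun r hr => (hb u r (hsub r hr)).2)
    rw [← Ioc_union_Ioc_eq_Ioc (zero_le) hlt.le, inter_union_distrib_left, encard_union_eq,
      ih (hlt.le.trans hn), h1, gridDeaths, gridDeaths, Finset.sum_range_succ]
    · push_cast
      rfl
    · exact (Ioc_disjoint_Ioc_of_le le_rfl).mono inter_subset_right inter_subset_right

variable {Ω : Type*}

theorem deathNumber_coe (X : ℝ≥0 → Ω → ℕ) (t : ℝ≥0) (ω : Ω) :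
    deathNumber X t ω = (deathTimes (fun s => X s ω) ∩ Ioc 0 t).encard := by
  rw [deathNumber]
  congr 1
  ext s
  simp only [deathTimes, mem_ofPred_eq, mem_inter_iff, mem_Ioc, ENNReal.coe_le_coe]
  tauto

/-- The mesh of the grid that divides `[0, t]` into `n + 1` parts. -/
noncomputable def mesh (t : ℝ≥0) (n : ℕ) : ℝ≥0 := t / (n + 1)

theorem succ_mul_mesh (t : ℝ≥0) (n : ℕ) : ((n + 1 : ℕ) : ℝ≥0) * mesh t n = t := by
  rw [mesh]
  push_cast
  field_simp

theorem tendsto_mesh (t : ℝ≥0) : Tendsto (fun n => (mesh t n : ℝ)) atTop (𝓝 0) := by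
  have := (tendsto_one_div_add_atTop_nhds_zero_nat (𝕜 := ℝ)).const_mul (t : ℝ)
  rw [mul_zero] at this
  refine this.congr fun n => ?_
  simp [mesh, div_eq_mul_inv]

theorem eventually_deathNumber_eq {X : ℝ≥0 → Ω → ℕ} {ω : Ω}
    (hr : ∀ t, ContinuousWithinAt (fun s => X s ω) (Ici t) t)
    (hl : ∀ t, ∃ l, Tendsto (fun s => X s ω) (𝓝[<] t) (𝓝 l)) {t : ℝ≥0} (ht : 0 < t) :
    ∀ᶠ n in atTop, deathNumber X t ω = gridDeaths (fun s => X s ω) (mesh t n) (n + 1) := by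
  obtain ⟨δ, hδ, h1⟩ := exists_encard_deathTimes_eq_gridDeaths hr hl t
  filter_upwards [(tendsto_mesh t).eventually_lt_const hδ] with n hn
  have h2 := h1 (mesh t n) (n + 1) (by unfold mesh; positivity) hn (succ_mul_mesh t n).le
  rwa [succ_mul_mesh, ← deathNumber_coe] at h2

theorem deathNumber_coe_lt_top {X : ℝ≥0 → Ω → ℕ} {ω : Ω}
    (hr : ∀ t, ContinuousWithinAt (fun s => X s ω) (Ici t) t)
    (hl : ∀ t, ∃ l, Tendsto (fun s => X s ω) (𝓝[<] t) (𝓝 l)) (t : ℝ≥0) :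
    deathNumber X t ω < ⊤ := by
  rcases eq_zero_or_pos t with rfl | ht
  · rw [deathNumber_coe]
    simp
  · obtain ⟨n, hn⟩ := (eventually_deathNumber_eq hr hl ht).exists
    rw [hn]
    exact ENat.natCast_lt_top _

/-- The number of deaths until time `t`, as a natural number. -/
noncomputable def deathCount (X : ℝ≥0 → Ω → ℕ) (t : ℝ≥0) (ω : Ω) : ℕ := (deathNumber X t ω).toNat

theorem eventually_gridDeaths_eq_deathCount
    (hr : ∀ ω t, ContinuousWithinAt (fun s => X s ω) (Ici t) t)
    (hl : ∀ ω t, ∃ l, Tendsto (fun s => X s ω) (𝓝[<] t) (𝓝 l)) {t : ℝ≥0} (ht : 0 < t) (ω : Ω) :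
    ∀ᶠ n in atTop, gridDeaths (fun s => X s ω) (mesh t n) (n + 1) = deathCount X t ω := by
  filter_upwards [eventually_deathNumber_eq (hr ω) (hl ω) ht] with n hn
  rw [deathCount, hn, ENat.toNat_natCast]

end MBP

/-! ### Means along the skeleton chain -/

namespace MBP

variable {Ω : Type*}

/-- The factor `v` of a down-step from `i` to `j`, and `1` otherwise. -/
def weight (v : ℝ) (i j : ℕ) : ℝ := if i = j + 1 then v else 1

theorem weight_nonneg {v : ℝ} (hv : 0 ≤ v) (i j : ℕ) : 0 ≤ weight v i j := by
  unfold weight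
  split_ifs <;> linarith

theorem weight_le_one {v : ℝ} (hv : v ≤ 1) (i j : ℕ) : weight v i j ≤ 1 := by
  unfold weight
  split_ifs <;> linarith

theorem pow_gridDeaths_succ (v : ℝ) (x : ℝ≥0 → ℕ) (h : ℝ≥0) (n : ℕ) :
    v ^ gridDeaths x h (n + 1) =
      v ^ gridDeaths x h n * weight v (x (n * h)) (x ((n + 1 : ℕ) * h)) := by
  rw [gridDeaths, Finset.sum_range_succ, pow_add, weight]
  congr 1
  split_ifs <;> simp

theorem measurable_past (X : ℝ≥0 → Ω → ℕ) {r s : ℝ≥0} (h : r ≤ s) :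
    Measurable[past X s] (X r) :=
  (comap_measurable (X r)).mono (le_iSup₂_of_le r h le_rfl) le_rfl

theorem measurable_gridDeaths {m : MeasurableSpace Ω} {X : ℝ≥0 → Ω → ℕ} {h : ℝ≥0} {n : ℕ}
    (hX : ∀ k ≤ n, Measurable (X (k * h))) :
    Measurable fun ω => gridDeaths (fun s => X s ω) h n := by
  unfold gridDeaths
  refine Finset.measurable_fun_sum _ fun k hk => ?_
  have hk' := Finset.mem_range.1 hk
  exact (measurable_of_countable fun a : ℕ × ℕ => if a.1 = a.2 + 1 then 1 else 0).comp
    ((hX k hk'.le).prodMk (hX (k + 1) hk'))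

variable [MeasurableSpace Ω] {μ : Measure Ω} {X : ℝ≥0 → Ω → ℕ}

theorem past_le (hX : ∀ t, Measurable (X t)) (s : ℝ≥0) : past X s ≤ ‹MeasurableSpace Ω› :=
  iSup₂_le fun r _ => (hX r).comap_le

theorem hasSum_integral_of_geometric_bound [IsProbabilityMeasure μ] {F : ℕ → Ω → ℝ} {ρ : ℝ}
    (hρ0 : 0 ≤ ρ) (hρ1 : ρ < 1) (hF : ∀ j, Measurable (F j)) (hb : ∀ j ω, |F j ω| ≤ ρ ^ j) :
    HasSum (fun j => ∫ ω, F j ω ∂μ) (∫ ω, ∑' j, F j ω ∂μ) := by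
  have hint : ∀ j, Integrable (F j) μ := fun j =>
    Integrable.of_bound (hF j).aestronglyMeasurable (ρ ^ j) (ae_of_all _ (hb j))
  refine hasSum_integral_of_summable_integral_norm hint ?_
  refine Summable.of_nonneg_of_le (fun j => integral_nonneg fun _ => norm_nonneg _) (fun j => ?_)
    (summable_geometric_of_lt_one hρ0 hρ1)
  refine (integral_mono (hint j).norm (integrable_const _) (hb j)).trans_eq ?_
  simp

/-- The Markov property at time `s`, integrated against a function of the past. -/
theorem integral_mul_eq_integral_mul_tsum [IsProbabilityMeasure μ] {r : ℕ → ℝ}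
    {P : ℝ≥0 → ℕ → ℕ → ℝ} (hX : ∀ t, Measurable (X t)) (hP : IsTransitionFunction r P)
    {s h : ℝ≥0}
    (hm : ∀ j, μ⟦X (s + h) ⁻¹' {j} | past X s⟧ =ᵐ[μ] fun ω => P h (X s ω) j)
    {Z : Ω → ℝ} (hZ : Measurable[past X s] Z) (hZb : ∀ ω, |Z ω| ≤ 1) {g : ℕ → ℕ → ℝ} {ρ : ℝ}
    (hρ0 : 0 ≤ ρ) (hρ1 : ρ < 1) (hg : ∀ i j, |g i j| ≤ ρ ^ j) :
    ∫ ω, Z ω * g (X s ω) (X (s + h) ω) ∂μ =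
      ∫ ω, Z ω * ∑' j, P h (X s ω) j * g (X s ω) j ∂μ := by
  have hZ' : Measurable Z := hZ.mono (past_le hX s) le_rfl
  have hZg : ∀ j, Measurable[past X s] fun ω => Z ω * g (X s ω) j := fun j =>
    hZ.mul ((measurable_of_countable fun i => g i j).comp (measurable_past X le_rfl))
  have hZgb : ∀ j ω, |Z ω * g (X s ω) j| ≤ ρ ^ j := fun j ω => by
    rw [abs_mul]
    have := mul_le_mul (hZb ω) (hg (X s ω) j) (abs_nonneg _) zero_le_one
    rwa [one_mul] at this
  -- The Markov property is given only for single target states, so the integral is split over the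
  -- value `j` of `X (s + h)`; the bounds `ρ ^ j` justify resumming.
  have h1 : ∀ j, ∫ ω, (Z ω * g (X s ω) j) * (X (s + h) ⁻¹' {j}).indicator (fun _ => (1 : ℝ)) ω ∂μ =
      ∫ ω, (Z ω * g (X s ω) j) * P h (X s ω) j ∂μ := by
    intro j
    have hS : MeasurableSet (X (s + h) ⁻¹' {j}) := hX _ (measurableSet_singleton j)
    have hi : Integrable ((X (s + h) ⁻¹' {j}).indicator fun _ => (1 : ℝ)) μ :=
      (integrable_const 1).indicator hS
    have hmul := condExp_mul_of_stronglyMeasurable_left (μ := μ) (m := past X s)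
      (hZg j).stronglyMeasurable
      (hi.bdd_mul (c := ρ ^ j) ((hZg j).mono (past_le hX s) le_rfl).aestronglyMeasurable
        (ae_of_all _ (hZgb j))) hi
    have h2 := integral_condExp (μ := μ) (past_le hX s)
      (f := (fun ω => Z ω * g (X s ω) j) * (X (s + h) ⁻¹' {j}).indicator fun _ => (1 : ℝ))
    refine h2.symm.trans (integral_congr_ae ?_)
    filter_upwards [hmul, hm j] with ω h3 h4
    rw [h3, Pi.mul_apply, h4]
  have hA := hasSum_integral_of_geometric_bound (μ := μ) hρ0 hρ1
    (F := fun j ω => (Z ω * g (X s ω) j) * (X (s + h) ⁻¹' {j}).indicator (fun _ => (1 : ℝ)) ω)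
    (fun j => ((hZg j).mono (past_le hX s) le_rfl).mul
      (measurable_const.indicator (hX _ (measurableSet_singleton j))))
    (fun j ω => by
      rw [abs_mul]
      refine (mul_le_of_le_one_right (abs_nonneg _) ?_).trans (hZgb j ω)
      by_cases hω : ω ∈ X (s + h) ⁻¹' {j} <;> simp [hω])
  have hB := hasSum_integral_of_geometric_bound (μ := μ) hρ0 hρ1
    (F := fun j ω => (Z ω * g (X s ω) j) * P h (X s ω) j)
    (fun j => ((hZg j).mono (past_le hX s) le_rfl).mul
      ((measurable_of_countable fun i => P h i j).comp (hX s)))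
    (fun j ω => by
      rw [abs_mul]
      exact (mul_le_of_le_one_right (abs_nonneg _) (hP.abs_le_one _ _ _)).trans (hZgb j ω))
  simp only [h1] at hA
  have hAB := hA.unique hB
  convert hAB using 1
  · congr 1
    funext ω
    rw [tsum_eq_single (X (s + h) ω)]
    · simp
    · intro j hj
      rw [indicator_of_notMem, mul_zero]
      exact fun hω => hj hω.symm
  · congr 1
    funext ω
    rw [← tsum_mul_left]
    congr 1
    funext j
    ring

/-- The expectation of `v ^ N * f (X (n h))`, where `N` is the number of down-steps of the
skeleton of mesh `h` up to time `n h`. -/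
noncomputable def skeletonMean (μ : Measure Ω) (X : ℝ≥0 → Ω → ℕ) (v : ℝ) (f : ℕ → ℝ) (h : ℝ≥0)
    (n : ℕ) : ℝ :=
  ∫ ω, v ^ gridDeaths (fun s => X s ω) h n * f (X (n * h) ω) ∂μ

section skeleton

variable [IsProbabilityMeasure μ] {r : ℕ → ℝ} {P : ℝ≥0 → ℕ → ℕ → ℝ} {v ρ ε θ : ℝ} {f : ℕ → ℝ}
  {h : ℝ≥0}

theorem skeletonMean_succ (hX : ∀ t, Measurable (X t)) (hP : IsTransitionFunction r P)
    (hm : ∀ s t j, μ⟦X (s + t) ⁻¹' {j} | past X s⟧ =ᵐ[μ] fun ω => P t (X s ω) j)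
    (hv0 : 0 ≤ v) (hv1 : v ≤ 1) (hρ0 : 0 ≤ ρ) (hρ1 : ρ < 1) (hf : ∀ j, |f j| ≤ ρ ^ j) (n : ℕ) :
    skeletonMean μ X v f h (n + 1) = ∫ ω, v ^ gridDeaths (fun s => X s ω) h n *
      ∑' j, P h (X (n * h) ω) j * (weight v (X (n * h) ω) j * f j) ∂μ := by
  have hZ : Measurable[past X (n * h)] fun ω => v ^ gridDeaths (fun s => X s ω) h n :=
    (measurable_of_countable fun k : ℕ => v ^ k).comp (measurable_gridDeaths fun k hk =>
      measurable_past X (by gcongr))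
  have hstep : ((n + 1 : ℕ) : ℝ≥0) * h = n * h + h := by push_cast; ring
  have h1 := integral_mul_eq_integral_mul_tsum (g := fun i j => weight v i j * f j) hX hP
    (hm (n * h) h) hZ
    (fun ω => by
      rw [abs_of_nonneg (by positivity)]
      exact pow_le_one₀ hv0 hv1) hρ0 hρ1
    (fun i j => by
      rw [abs_mul, abs_of_nonneg (weight_nonneg hv0 i j)]
      exact (mul_le_of_le_one_left (abs_nonneg _) (weight_le_one hv1 i j)).trans (hf j))
  rw [← h1, skeletonMean, hstep]
  simp only [pow_gridDeaths_succ, hstep, mul_assoc]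

theorem integrable_pow_gridDeaths_mul (hX : ∀ t, Measurable (X t)) (hv0 : 0 ≤ v) (hv1 : v ≤ 1)
    {M : ℝ} {g : ℕ → ℝ} (hg : ∀ j, |g j| ≤ M) (t : ℝ≥0) (n : ℕ) :
    Integrable (fun ω => v ^ gridDeaths (fun s => X s ω) h n * g (X t ω)) μ := by
  refine Integrable.of_bound (((measurable_of_countable fun k : ℕ => v ^ k).comp
    (measurable_gridDeaths fun k _ => hX _)).mul
      ((measurable_of_countable g).comp (hX t))).aestronglyMeasurable M (ae_of_all _ fun ω => ?_)
  rw [Real.norm_eq_abs, abs_mul, abs_of_nonneg (by positivity)]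
  exact (mul_le_of_le_one_left (abs_nonneg _) (pow_le_one₀ hv0 hv1)).trans (hg _)

theorem abs_tsum_weight_le (hP : IsTransitionFunction r P) (hv0 : 0 ≤ v) (hv1 : v ≤ 1)
    (hρ0 : 0 ≤ ρ) (hρ1 : ρ < 1) (hf : ∀ j, |f j| ≤ ρ ^ j) (i : ℕ) :
    |∑' j, P h i j * (weight v i j * f j)| ≤ 1 := by
  have := tsum_of_norm_bounded (hP.hasSum_one h i)
    (f := fun j => P h i j * (weight v i j * f j)) fun j => by
      rw [norm_mul, Real.norm_of_nonneg (hP.nonneg _ _ _), Real.norm_eq_abs, abs_mul,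
        abs_of_nonneg (weight_nonneg hv0 i j)]
      exact mul_le_of_le_one_right (hP.nonneg _ _ _) (mul_le_one₀ (weight_le_one hv1 i j)
        (abs_nonneg _) ((hf j).trans (pow_le_one₀ hρ0 hρ1.le)))
  exact this

/-- Iterates the one-step bound `T f ≤ θ f + ε`, where `T` is the weighted one-step operator. Since
`θ ≤ 1` and the accumulated factors of `v` are at most `1`, each step adds at most `ε`. The
martingale case uses `θ = 1`, the decay case `θ = 1 - h b κ`. -/
theorem skeletonMean_le (hX : ∀ t, Measurable (X t)) (hP : IsTransitionFunction r P)
    (hm : ∀ s t j, μ⟦X (s + t) ⁻¹' {j} | past X s⟧ =ᵐ[μ] fun ω => P t (X s ω) j)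
    (hv0 : 0 ≤ v) (hv1 : v ≤ 1) (hρ0 : 0 ≤ ρ) (hρ1 : ρ < 1) (hf : ∀ j, |f j| ≤ ρ ^ j)
    (hθ0 : 0 ≤ θ) (hθ1 : θ ≤ 1) (hε : 0 ≤ ε)
    (hT : ∀ i, ∑' j, P h i j * (weight v i j * f j) ≤ θ * f i + ε) (n : ℕ) :
    skeletonMean μ X v f h n ≤ θ ^ n * skeletonMean μ X v f h 0 + n * ε := by
  induction n with
  | zero => simp
  | succ n ih =>
    have hf1 : ∀ j, |f j| ≤ 1 := fun j => (hf j).trans (pow_le_one₀ hρ0 hρ1.le)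
    have h1 : skeletonMean μ X v f h (n + 1) ≤ θ * skeletonMean μ X v f h n + ε := by
      rw [skeletonMean_succ hX hP hm hv0 hv1 hρ0 hρ1 hf, skeletonMean, ← integral_const_mul]
      have h2 : ∫ _ω, ε ∂μ = ε := by simp
      refine le_of_le_of_eq ?_ (congrArg (_ + ·) h2)
      have h3 := (integrable_pow_gridDeaths_mul (μ := μ) (h := h) hX hv0 hv1 hf1 (n * h) n).const_mul θ
      rw [← integral_add h3 (integrable_const ε)]
      refine integral_mono (integrable_pow_gridDeaths_mul (h := h) hX hv0 hv1
        (g := fun i => ∑' j, P h i j * (weight v i j * f j))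
        (abs_tsum_weight_le hP hv0 hv1 hρ0 hρ1 hf) (n * h) n) (h3.add (integrable_const ε)) ?_
      intro ω
      have h4 : 0 ≤ v ^ gridDeaths (fun s => X s ω) h n := by positivity
      have h5 : v ^ gridDeaths (fun s => X s ω) h n ≤ 1 := pow_le_one₀ hv0 hv1
      have h6 := mul_le_mul_of_nonneg_left (hT (X (n * h) ω)) h4
      have h7 := mul_le_mul_of_nonneg_right h5 hε
      change _ ≤ _ + _
      linarith
    have h2 := mul_le_mul_of_nonneg_left ih hθ0
    have h3 : θ * (n * ε) ≤ n * ε := mul_le_of_le_one_left (by positivity) hθ1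
    rw [pow_succ']
    push_cast
    linarith

theorem le_skeletonMean (hX : ∀ t, Measurable (X t)) (hP : IsTransitionFunction r P)
    (hm : ∀ s t j, μ⟦X (s + t) ⁻¹' {j} | past X s⟧ =ᵐ[μ] fun ω => P t (X s ω) j)
    (hv0 : 0 ≤ v) (hv1 : v ≤ 1) (hρ0 : 0 ≤ ρ) (hρ1 : ρ < 1) (hf : ∀ j, |f j| ≤ ρ ^ j)
    (hε : 0 ≤ ε) (hT : ∀ i, f i - ε ≤ ∑' j, P h i j * (weight v i j * f j)) (n : ℕ) :
    skeletonMean μ X v f h 0 - n * ε ≤ skeletonMean μ X v f h n := by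
  have h1 := skeletonMean_le (f := fun j => -f j) (θ := 1) hX hP hm hv0 hv1 hρ0 hρ1
    (fun j => by rw [abs_neg]; exact hf j) zero_le_one le_rfl hε
    (fun i => by
      simp only [mul_neg, tsum_neg]
      linarith [hT i]) n
  simp only [skeletonMean, mul_neg, integral_neg, one_pow, one_mul] at h1
  simp only [skeletonMean]
  linarith

end skeleton

theorem measurable_deathCount (hX : ∀ t, Measurable (X t))
    (hr : ∀ ω t, ContinuousWithinAt (fun s => X s ω) (Ici t) t)
    (hl : ∀ ω t, ∃ l, Tendsto (fun s => X s ω) (𝓝[<] t) (𝓝 l)) {t : ℝ≥0} (ht : 0 < t) :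
    Measurable (deathCount X t) := by
  refine measurable_of_tendsto_metrizable
    (f := fun n ω => gridDeaths (fun s => X s ω) (mesh t n) (n + 1))
    (fun n => measurable_gridDeaths fun k _ => hX _) (tendsto_pi_nhds.2 fun ω => ?_)
  exact tendsto_nhds_of_eventually_eq (eventually_gridDeaths_eq_deathCount hr hl ht ω)

theorem tendsto_skeletonMean [IsProbabilityMeasure μ] (hX : ∀ t, Measurable (X t))
    (hr : ∀ ω t, ContinuousWithinAt (fun s => X s ω) (Ici t) t)
    (hl : ∀ ω t, ∃ l, Tendsto (fun s => X s ω) (𝓝[<] t) (𝓝 l)) {t : ℝ≥0} (ht : 0 < t) {v : ℝ}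
    (hv0 : 0 ≤ v) (hv1 : v ≤ 1) {f : ℕ → ℝ} (hf : ∀ j, |f j| ≤ 1) :
    Tendsto (fun n => skeletonMean μ X v f (mesh t n) (n + 1)) atTop
      (𝓝 (∫ ω, v ^ deathCount X t ω * f (X t ω) ∂μ)) := by
  unfold skeletonMean
  refine tendsto_integral_of_dominated_convergence (fun _ => 1)
    (fun n => (integrable_pow_gridDeaths_mul hX hv0 hv1 hf _ _).aestronglyMeasurable)
    (integrable_const 1) (fun n => ae_of_all _ fun ω => ?_) (ae_of_all _ fun ω => ?_)
  · rw [norm_mul, Real.norm_of_nonneg (by positivity)]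
    exact mul_le_one₀ (pow_le_one₀ hv0 hv1) (norm_nonneg _) (hf _)
  · refine tendsto_nhds_of_eventually_eq ?_
    filter_upwards [eventually_gridDeaths_eq_deathCount hr hl ht ω] with n hn
    rw [hn, succ_mul_mesh]

end MBP

/-! ### Extinction time, absorption at zero, measurability -/

namespace MBP

open TopologicalSpace
theorem exists_forall_Ico_eq {x : ℝ≥0 → ℕ} (hr : ∀ t, ContinuousWithinAt x (Ici t) t) (t : ℝ≥0) :
    ∃ u > t, ∀ s ∈ Ico t u, x s = x t := by
  have h := hr t
  rw [ContinuousWithinAt, nhds_discrete, tendsto_pure] at h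
  obtain ⟨u, hu, h1⟩ := mem_nhdsGE_iff_exists_Ico_subset.1 h
  exact ⟨u, hu, fun s hs => h1 hs⟩

/-- By right-continuity every value of the path is also taken at a point of a fixed countable dense
set, which reduces statements over all times to countably many. -/
theorem exists_denseSeq_eq {x : ℝ≥0 → ℕ} (hr : ∀ t, ContinuousWithinAt x (Ici t) t) {t u : ℝ≥0}
    (htu : t < u) : ∃ m, denseSeq ℝ≥0 m ∈ Ioo t u ∧ x (denseSeq ℝ≥0 m) = x t := by
  obtain ⟨w, hw, h⟩ := exists_forall_Ico_eq hr t
  obtain ⟨-, ⟨m, rfl⟩, hm⟩ := (denseRange_denseSeq ℝ≥0).exists_between (lt_min htu hw)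
  exact ⟨m, ⟨hm.1, hm.2.trans_le (min_le_left _ _)⟩,
    h _ ⟨hm.1.le, hm.2.trans_le (min_le_right _ _)⟩⟩

theorem eq_zero_of_denseSeq {x : ℝ≥0 → ℕ} (hr : ∀ t, ContinuousWithinAt x (Ici t) t)
    (hd : ∀ m n, denseSeq ℝ≥0 m ≤ denseSeq ℝ≥0 n → x (denseSeq ℝ≥0 m) = 0 →
      x (denseSeq ℝ≥0 n) = 0) {s t : ℝ≥0} (hst : s ≤ t) (hs : x s = 0) : x t = 0 := by
  rcases hst.eq_or_lt with rfl | hlt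
  · exact hs
  obtain ⟨m, hm1, hm2⟩ := exists_denseSeq_eq hr hlt
  obtain ⟨n, hn1, hn2⟩ := exists_denseSeq_eq hr (lt_add_one t)
  rw [← hn2]
  exact hd m n (hm1.2.trans hn1.1).le (hm2.trans hs)

variable {Ω : Type*}

theorem extinctionTime_lt_top_iff {X : ℝ≥0 → Ω → ℕ} {ω : Ω} :
    extinctionTime X ω < ∞ ↔ ∃ t, X t ω = 0 := by
  simp [extinctionTime, iInf_lt_iff]

theorem exists_extinctionTime_eq {X : ℝ≥0 → Ω → ℕ} {ω : Ω}
    (hr : ∀ t, ContinuousWithinAt (fun s => X s ω) (Ici t) t) (h : extinctionTime X ω < ∞) :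
    ∃ t : ℝ≥0, extinctionTime X ω = t ∧ X t ω = 0 := by
  have hne : {t | X t ω = 0}.Nonempty := extinctionTime_lt_top_iff.1 h
  have hglb := isGLB_csInf hne (OrderBot.bddBelow _)
  -- Zeros accumulate at (or occur at) the infimum from the right, and right-continuity makes the
  -- path constant just after it.
  have h0 : X (sInf {t | X t ω = 0}) ω = 0 := by
    have h1 := hr (sInf {t | X t ω = 0})
    rw [ContinuousWithinAt, nhds_discrete, tendsto_pure] at h1
    obtain ⟨s, hs1, hs2⟩ := ((hglb.frequently_mem hne).and_eventually h1).exists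
    exact hs2.symm.trans hs1
  refine ⟨sInf {t | X t ω = 0}, le_antisymm
    (iInf₂_le (f := fun (t : ℝ≥0) (_ : X t ω = 0) => (t : ℝ≥0∞)) _ h0) (le_iInf₂ fun t ht => ?_), h0⟩
  exact ENNReal.coe_le_coe.2 (hglb.1 ht)

theorem deathNumber_extinctionTime_lt_top {X : ℝ≥0 → Ω → ℕ} {ω : Ω}
    (hr : ∀ t, ContinuousWithinAt (fun s => X s ω) (Ici t) t)
    (hl : ∀ t, ∃ l, Tendsto (fun s => X s ω) (𝓝[<] t) (𝓝 l)) (h : extinctionTime X ω < ∞) :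
    deathNumber X (extinctionTime X ω) ω < ⊤ := by
  obtain ⟨t, ht, -⟩ := exists_extinctionTime_eq hr h
  rw [ht]
  exact deathNumber_coe_lt_top hr hl t

/-- There are no deaths after extinction. -/
theorem deathNumber_eq_of_extinctionTime_le {X : ℝ≥0 → Ω → ℕ} {ω : Ω}
    (hr : ∀ t, ContinuousWithinAt (fun s => X s ω) (Ici t) t)
    (h0 : ∀ s t, s ≤ t → X s ω = 0 → X t ω = 0) {t : ℝ≥0} (ht : X t ω = 0) :
    deathNumber X (extinctionTime X ω) ω = deathNumber X t ω := by
  obtain ⟨u, hu, hu0⟩ := exists_extinctionTime_eq hr (extinctionTime_lt_top_iff.2 ⟨t, ht⟩)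
  have hut : u ≤ t := by
    rw [← ENNReal.coe_le_coe, ← hu]
    exact iInf₂_le t ht
  rw [hu, deathNumber_coe, deathNumber_coe]
  congr 1
  ext s
  refine ⟨fun hs => ⟨hs.1, hs.2.1, hs.2.2.trans hut⟩, fun hs => ⟨hs.1, hs.2.1, ?_⟩⟩
  by_contra! hus
  -- A death after extinction would have left value `0 = X s ω + 1`.
  have h1 := (mem_deathTimes_iff (c := 0) hus fun r hr1 _ => h0 u r hr1 hu0).1 hs.1
  omega

/-- The total number of deaths if the population dies out, and `0` otherwise. -/
noncomputable def totalDeaths (X : ℝ≥0 → Ω → ℕ) (ω : Ω) : ℕ :=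
  {ω | extinctionTime X ω < ∞}.indicator
    (fun ω => (deathNumber X (extinctionTime X ω) ω).toNat) ω

theorem totalDeaths_of_lt_top {X : ℝ≥0 → Ω → ℕ} {ω : Ω} (hω : extinctionTime X ω < ∞) :
    totalDeaths X ω = (deathNumber X (extinctionTime X ω) ω).toNat :=
  indicator_of_mem (s := {ω | extinctionTime X ω < ∞}) hω _

theorem eventually_deathCount_eq {X : ℝ≥0 → Ω → ℕ}
    (hr : ∀ ω t, ContinuousWithinAt (fun s => X s ω) (Ici t) t)
    {ω : Ω} (h0 : ∀ s t, s ≤ t → X s ω = 0 → X t ω = 0) :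
    (ω ∈ {ω | extinctionTime X ω < ∞} ∧
      ∀ᶠ n : ℕ in atTop, X (n + 1) ω = 0 ∧ deathCount X (n + 1) ω = totalDeaths X ω) ∨
    (ω ∉ {ω | extinctionTime X ω < ∞} ∧ ∀ t, X t ω ≠ 0) := by
  by_cases hω : ω ∈ {ω | extinctionTime X ω < ∞}
  · refine Or.inl ⟨hω, ?_⟩
    obtain ⟨t, ht⟩ := extinctionTime_lt_top_iff.1 hω
    filter_upwards [(tendsto_natCast_atTop_atTop (R := ℝ≥0)).eventually_ge_atTop t] with n hn
    have h1 : X (n + 1) ω = 0 := h0 t _ (hn.trans le_self_add) ht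
    refine ⟨h1, ?_⟩
    rw [totalDeaths_of_lt_top hω, deathNumber_eq_of_extinctionTime_le (hr ω) h0 h1,
      deathCount]
  · exact Or.inr ⟨hω, fun t ht => hω (extinctionTime_lt_top_iff.2 ⟨t, ht⟩)⟩

variable [MeasurableSpace Ω] {μ : Measure Ω} {X : ℝ≥0 → Ω → ℕ}

theorem measurableSet_extinctionTime_lt_top (hX : ∀ t, Measurable (X t))
    (hr : ∀ ω t, ContinuousWithinAt (fun s => X s ω) (Ici t) t) :
    MeasurableSet {ω | extinctionTime X ω < ∞} := by
  have h : {ω | extinctionTime X ω < ∞} = ⋃ m, X (denseSeq ℝ≥0 m) ⁻¹' {0} := by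
    ext ω
    simp only [mem_ofPred_eq, extinctionTime_lt_top_iff, mem_iUnion, mem_preimage,
      mem_singleton_iff]
    constructor
    · rintro ⟨t, ht⟩
      obtain ⟨m, -, hm⟩ := exists_denseSeq_eq (hr ω) (lt_add_one t)
      exact ⟨m, hm.trans ht⟩
    · rintro ⟨m, hm⟩
      exact ⟨_, hm⟩
  rw [h]
  exact MeasurableSet.iUnion fun m => hX _ (measurableSet_singleton 0)

theorem ae_forall_eq_zero [IsProbabilityMeasure μ] {r : ℕ → ℝ} {P : ℝ≥0 → ℕ → ℕ → ℝ} {B : ℝ}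
    (hX : ∀ t, Measurable (X t)) (hr : ∀ ω t, ContinuousWithinAt (fun s => X s ω) (Ici t) t)
    (hP : IsTransitionFunction r P) (hB : ∀ j, |r j| ≤ B)
    (hm : ∀ s t j, μ⟦X (s + t) ⁻¹' {j} | past X s⟧ =ᵐ[μ] fun ω => P t (X s ω) j) :
    ∀ᵐ ω ∂μ, ∀ s t, s ≤ t → X s ω = 0 → X t ω = 0 := by
  have h1 : ∀ s t, s ≤ t → ∀ᵐ ω ∂μ, X s ω = 0 → X t ω = 0 := by
    intro s t hst
    obtain ⟨h, rfl⟩ := exists_add_of_le hst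
    have hS : MeasurableSet[past X s] (X s ⁻¹' {0}) :=
      measurable_past X le_rfl (measurableSet_singleton 0)
    have hS' := past_le hX s _ hS
    have hT : MeasurableSet (X (s + h) ⁻¹' {0}) := hX _ (measurableSet_singleton 0)
    have h2 := setIntegral_condExp (μ := μ) (past_le hX s)
      (f := (X (s + h) ⁻¹' {0}).indicator fun _ => (1 : ℝ)) ((integrable_const 1).indicator hT) hS
    have h3 : ∫ ω in X s ⁻¹' {0}, (μ⟦X (s + h) ⁻¹' {0} | past X s⟧) ω ∂μ =
        ∫ ω in X s ⁻¹' {0}, 1 ∂μ := by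
      refine setIntegral_congr_ae hS' ?_
      filter_upwards [hm s h 0] with ω h4 h5
      rw [h4, show X s ω = 0 from h5, hP.apply_zero_zero hB]
    rw [h3, setIntegral_indicator hT, setIntegral_const, setIntegral_const, smul_eq_mul,
      smul_eq_mul, mul_one, mul_one] at h2
    -- Integrating the conditional probability, which is `1` on `X s = 0`, shows that the
    -- intersection has the full measure of `X s ⁻¹' {0}`.
    have h4 : μ (X s ⁻¹' {0} \ X (s + h) ⁻¹' {0}) = 0 := by
      have h5 := measureReal_inter_add_sdiff (μ := μ) (s := X s ⁻¹' {0}) hT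
      rw [← measureReal_eq_zero_iff]
      linarith
    rw [ae_iff]
    convert h4 using 2
    ext ω
    simp
  have h2 : ∀ᵐ ω ∂μ, ∀ m n, denseSeq ℝ≥0 m ≤ denseSeq ℝ≥0 n → X (denseSeq ℝ≥0 m) ω = 0 →
      X (denseSeq ℝ≥0 n) ω = 0 := by
    rw [ae_all_iff]
    intro m
    rw [ae_all_iff]
    intro n
    by_cases hmn : denseSeq ℝ≥0 m ≤ denseSeq ℝ≥0 n
    · filter_upwards [h1 _ _ hmn] with ω hω _ using hω
    · exact ae_of_all _ fun ω h => absurd h hmn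
  filter_upwards [h2] with ω hω s t hst
  exact eq_zero_of_denseSeq (hr ω) hω hst

/-! ### Constant mean, exponential decay off extinction, and the limit -/

theorem skeletonMean_zero [IsProbabilityMeasure μ] (hX0 : ∀ᵐ ω ∂μ, X 0 ω = 1) (v : ℝ) (f : ℕ → ℝ)
    (h : ℝ≥0) : skeletonMean μ X v f h 0 = f 1 := by
  have : skeletonMean μ X v f h 0 = ∫ _ω, f 1 ∂μ := by
    refine integral_congr_ae ?_
    filter_upwards [hX0] with ω hω
    simp [gridDeaths, hω]
  simpa using this

theorem tendsto_succ_mul_mesh_sq (t : ℝ≥0) (C : ℝ) :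
    Tendsto (fun n => ((n + 1 : ℕ) : ℝ) * (C * (mesh t n : ℝ) ^ 2)) atTop (𝓝 0) := by
  have h := (tendsto_mesh t).const_mul (C * t)
  rw [mul_zero] at h
  refine h.congr fun n => ?_
  have h1 : ((n + 1 : ℕ) : ℝ) * mesh t n = t := by exact_mod_cast succ_mul_mesh t n
  nth_rewrite 1 [← h1]
  ring

section birthDeath

variable [IsProbabilityMeasure μ] {p q b v : ℝ} {P : ℝ≥0 → ℕ → ℕ → ℝ}

/-- `v ^ Y(t) * ρ ^ X(t)` has constant expectation if `ρ = p v + q ρ²`. -/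
theorem integral_pow_deathCount_mul_pow (hb : 0 < b) (hp : 0 < p) (hq : 0 < q) (hpq : p + q = 1)
    (hX : ∀ t, Measurable (X t)) (hr : ∀ ω t, ContinuousWithinAt (fun s => X s ω) (Ici t) t)
    (hl : ∀ ω t, ∃ l, Tendsto (fun s => X s ω) (𝓝[<] t) (𝓝 l))
    (hP : IsTransitionFunction (birthDeathRates p q b) P)
    (hm : ∀ s t j, μ⟦X (s + t) ⁻¹' {j} | past X s⟧ =ᵐ[μ] fun ω => P t (X s ω) j)
    (hX0 : ∀ᵐ ω ∂μ, X 0 ω = 1) (hv0 : 0 ≤ v) (hv1 : v ≤ 1) {ρ : ℝ} (hρ0 : 0 ≤ ρ) (hρ1 : ρ < 1)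
    (hρ : p * v - ρ + q * ρ ^ 2 = 0) {t : ℝ≥0} (ht : 0 < t) :
    ∫ ω, v ^ deathCount X t ω * ρ ^ X t ω ∂μ = ρ := by
  have hB := abs_birthDeathRates_le hp.le hq.le hpq hb
  obtain ⟨C, hC0, hC⟩ := hP.exists_abs_tsum_sub_le hB hρ0 hρ1
  have hf : ∀ j, |ρ ^ j| ≤ ρ ^ j := fun j => (abs_of_nonneg (by positivity)).le
  have hT : ∀ (h : ℝ≥0) (i : ℕ),
      |∑' j, P h i j * (weight v i j * ρ ^ j) - ρ ^ i| ≤ C * (h : ℝ) ^ 2 := by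
    intro h i
    refine hC h i _ _ (fun j => ?_) ?_
    · rw [abs_mul, abs_of_nonneg (weight_nonneg hv0 i j)]
      exact (mul_le_of_le_one_left (abs_nonneg _) (weight_le_one hv1 i j)).trans (hf j)
    · cases i with
      | zero =>
        convert hasSum_ite_add_qMatrix_zero _ _ _ using 1
        simp [weight]
      | succ i =>
        -- The weight turns the term at `i` into `v * ρ ^ i`, so the bracket is `ρ ^ i * (p v - ρ +
        -- q ρ²) = 0`.
        convert hasSum_ite_add_qMatrix_succ p q b h _ i using 1
        simp only [weight, if_true, Nat.left_eq_add, one_ne_zero, if_false,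
          show ¬(i + 1 = i + 2 + 1) by omega]
        linear_combination (-(h * (i + 1) * b * ρ ^ i)) * hρ
  have h1 : ∀ n, |skeletonMean μ X v (fun j => ρ ^ j) (mesh t n) (n + 1) - ρ| ≤
      ((n + 1 : ℕ) : ℝ) * (C * (mesh t n : ℝ) ^ 2) := by
    intro n
    have hu := skeletonMean_le (θ := 1) (ε := C * (mesh t n : ℝ) ^ 2) hX hP hm hv0 hv1 hρ0 hρ1 hf
      zero_le_one le_rfl (by positivity)
      (fun i => by linarith [(abs_le.1 (hT (mesh t n) i)).2]) (n + 1)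
    have hd := le_skeletonMean (ε := C * (mesh t n : ℝ) ^ 2) hX hP hm hv0 hv1 hρ0 hρ1 hf
      (by positivity) (fun i => by linarith [(abs_le.1 (hT (mesh t n) i)).1]) (n + 1)
    rw [skeletonMean_zero hX0] at hu hd
    simp only [one_pow, one_mul, pow_one] at hu hd
    rw [abs_le]
    constructor <;> linarith
  have h2 := tendsto_skeletonMean (μ := μ) hX hr hl ht hv0 hv1 (f := fun j => ρ ^ j)
    (fun j => (hf j).trans (pow_le_one₀ hρ0 hρ1.le))
  refine tendsto_nhds_unique h2 ?_
  rw [tendsto_iff_norm_sub_tendsto_zero]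
  exact squeeze_zero (fun _ => norm_nonneg _) h1 (tendsto_succ_mul_mesh_sq t C)

/-- The part of `v ^ Y(t) * ρ ^ X(t)` off extinction decays exponentially in mean if
`p v + q ρ² < ρ`. -/
theorem integral_pow_deathCount_mul_ite_le (hb : 0 < b) (hp : 0 < p) (hq : 0 < q)
    (hpq : p + q = 1)
    (hX : ∀ t, Measurable (X t)) (hr : ∀ ω t, ContinuousWithinAt (fun s => X s ω) (Ici t) t)
    (hl : ∀ ω t, ∃ l, Tendsto (fun s => X s ω) (𝓝[<] t) (𝓝 l))
    (hP : IsTransitionFunction (birthDeathRates p q b) P)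
    (hm : ∀ s t j, μ⟦X (s + t) ⁻¹' {j} | past X s⟧ =ᵐ[μ] fun ω => P t (X s ω) j)
    (hX0 : ∀ᵐ ω ∂μ, X 0 ω = 1) (hv0 : 0 ≤ v) (hv1 : v ≤ 1) {ρ κ : ℝ} (hρ0 : 0 ≤ ρ) (hρ1 : ρ < 1)
    (hκ0 : 0 < κ) (hκ : p * v - ρ + q * ρ ^ 2 ≤ -κ) {t : ℝ≥0} (ht : 0 < t) :
    ∫ ω, v ^ deathCount X t ω * (if X t ω = 0 then 0 else ρ ^ X t ω) ∂μ ≤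
      Real.exp (-(b * κ * t)) := by
  have hB := abs_birthDeathRates_le hp.le hq.le hpq hb
  obtain ⟨C, hC0, hC⟩ := hP.exists_abs_tsum_sub_le hB hρ0 hρ1
  set f : ℕ → ℝ := fun j => if j = 0 then 0 else ρ ^ j with hfdef
  have hf : ∀ j, |f j| ≤ ρ ^ j := by
    intro j
    simp only [hfdef]
    split_ifs
    · rw [abs_zero]; positivity
    · exact (abs_of_nonneg (by positivity)).le
  have hT : ∀ (h : ℝ≥0) (i : ℕ), ∑' j, P h i j * (weight v i j * f j) ≤
      (1 - h * (b * κ)) * f i + C * (h : ℝ) ^ 2 := by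
    intro h i
    have hg : ∀ j, |weight v i j * f j| ≤ ρ ^ j := fun j => by
      rw [abs_mul, abs_of_nonneg (weight_nonneg hv0 i j)]
      exact (mul_le_of_le_one_left (abs_nonneg _) (weight_le_one hv1 i j)).trans (hf j)
    cases i with
    | zero =>
      have := (abs_le.1 (hC h 0 _ _ hg (hasSum_ite_add_qMatrix_zero _ _ _))).2
      simp only [hfdef, if_true, mul_zero, sub_zero, zero_add] at this ⊢
      exact this
    | succ i =>
      have := (abs_le.1 (hC h (i + 1) _ _ hg (hasSum_ite_add_qMatrix_succ p q b h _ i))).2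
      have hfi : f i ≤ ρ ^ i := (le_abs_self _).trans (hf i)
      have hf1 : f (i + 1) = ρ ^ (i + 1) := by simp [hfdef]
      have hf2 : f (i + 2) = ρ ^ (i + 2) := by simp [hfdef]
      have hw0 : weight v (i + 1) i = v := if_pos rfl
      have hw1 : weight v (i + 1) (i + 1) = 1 := if_neg (by omega)
      have hw2 : weight v (i + 1) (i + 2) = 1 := if_neg (by omega)
      simp only [hw0, hw1, hw2, one_mul, hf1, hf2] at this
      rw [hf1]
      have h1 : p * (v * f i) - ρ ^ (i + 1) + q * ρ ^ (i + 2) ≤ -κ * ρ ^ i := by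
        have h2 := mul_le_mul_of_nonneg_left hfi (mul_nonneg hp.le hv0)
        have h3 := mul_le_mul_of_nonneg_right hκ (pow_nonneg hρ0 i)
        have h4 : ρ ^ (i + 1) = ρ * ρ ^ i := pow_succ' _ _
        have h5 : ρ ^ (i + 2) = ρ ^ 2 * ρ ^ i := by ring
        rw [h4, h5]
        linarith
      have h2 : h * ((i : ℝ) + 1) * b * (p * (v * f i) - ρ ^ (i + 1) + q * ρ ^ (i + 2)) ≤
          h * (i + 1) * b * (-κ * ρ ^ i) := mul_le_mul_of_nonneg_left h1 (by positivity)
      -- The total jump rate is at least `b` at every nonzero state, so the relative decay rate `b *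
      -- κ` works for all `i` at once.
      have h3 : ρ ^ (i + 1) ≤ (i + 1) * ρ ^ i := by
        have h4 : ρ ^ (i + 1) ≤ ρ ^ i := pow_le_pow_of_le_one hρ0 hρ1.le (Nat.le_succ i)
        have h5 : 0 ≤ (i : ℝ) * ρ ^ i := by positivity
        linarith
      have h4 := mul_le_mul_of_nonneg_left h3 (show 0 ≤ h * (b * κ) by positivity)
      linarith
  have h1 := tendsto_skeletonMean (μ := μ) hX hr hl ht hv0 hv1 (f := f)
    (fun j => (hf j).trans (pow_le_one₀ hρ0 hρ1.le))
  have h2 := (tendsto_succ_mul_mesh_sq t C).const_add (Real.exp (-(b * κ * t)))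
  rw [add_zero] at h2
  refine le_of_tendsto_of_tendsto h1 h2 ?_
  have h3 := (tendsto_mesh t).mul_const (b * κ)
  rw [zero_mul] at h3
  filter_upwards [h3.eventually_lt_const zero_lt_one] with n hn
  have hθ0 : 0 ≤ 1 - mesh t n * (b * κ) := by linarith
  have hθ1 : 1 - mesh t n * (b * κ) ≤ 1 := by
    have : 0 ≤ mesh t n * (b * κ) := by positivity
    linarith
  refine (skeletonMean_le hX hP hm hv0 hv1 hρ0 hρ1 hf hθ0 hθ1 (by positivity)
    (hT (mesh t n)) (n + 1)).trans ?_
  rw [skeletonMean_zero hX0]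
  refine add_le_add_left ?_ _
  have hf1 : f 1 ≤ 1 := (le_abs_self _).trans ((hf 1).trans (pow_le_one₀ hρ0 hρ1.le))
  refine (mul_le_of_le_one_right (pow_nonneg hθ0 _) hf1).trans ?_
  have h4 : 1 - mesh t n * (b * κ) ≤ Real.exp (-(mesh t n * (b * κ))) :=
    Real.one_sub_le_exp_neg _
  refine (pow_le_pow_left₀ hθ0 h4 (n + 1)).trans_eq ?_
  have h5 : ((n + 1 : ℕ) : ℝ) * mesh t n = t := by exact_mod_cast succ_mul_mesh t n
  rw [← Real.exp_nat_mul, ← h5]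
  congr 1
  ring

end birthDeath

/-- Limit of the death counts at integer times, restricted to extinction. The limit is identified
only on paths that stay at `0`, hence almost everywhere. -/
theorem aemeasurable_totalDeaths (hX : ∀ t, Measurable (X t))
    (hr : ∀ ω t, ContinuousWithinAt (fun s => X s ω) (Ici t) t)
    (hl : ∀ ω t, ∃ l, Tendsto (fun s => X s ω) (𝓝[<] t) (𝓝 l))
    (h0 : ∀ᵐ ω ∂μ, ∀ s t, s ≤ t → X s ω = 0 → X t ω = 0) : AEMeasurable (totalDeaths X) μ := by
  refine aemeasurable_of_tendsto_metrizable_ae' (f := fun (n : ℕ) =>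
    {ω | extinctionTime X ω < ∞}.indicator (deathCount X (n + 1))) (fun n =>
      ((measurable_deathCount hX hr hl (by positivity)).indicator
        (measurableSet_extinctionTime_lt_top hX hr)).aemeasurable) ?_
  filter_upwards [h0] with ω hω
  refine tendsto_nhds_of_eventually_eq ?_
  rcases eventually_deathCount_eq hr hω with ⟨h1, h2⟩ | ⟨h1, -⟩
  · filter_upwards [h2] with n hn
    rw [indicator_of_mem h1, hn.2]
  · refine Eventually.of_forall fun n => ?_
    rw [indicator_of_notMem h1, totalDeaths, indicator_of_notMem h1]

section birthDeath

variable [IsProbabilityMeasure μ] {p q b v : ℝ} {P : ℝ≥0 → ℕ → ℕ → ℝ}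

theorem setIntegral_pow_totalDeaths_of_lt_one (hb : 0 < b) (hp : 0 < p) (hq : 0 < q)
    (hpq : p + q = 1)
    (hX : ∀ t, Measurable (X t)) (hr : ∀ ω t, ContinuousWithinAt (fun s => X s ω) (Ici t) t)
    (hl : ∀ ω t, ∃ l, Tendsto (fun s => X s ω) (𝓝[<] t) (𝓝 l))
    (hP : IsTransitionFunction (birthDeathRates p q b) P)
    (hm : ∀ s t j, μ⟦X (s + t) ⁻¹' {j} | past X s⟧ =ᵐ[μ] fun ω => P t (X s ω) j)
    (hX0 : ∀ᵐ ω ∂μ, X 0 ω = 1) (hv0 : 0 ≤ v) (hv1 : v < 1) :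
    ∫ ω in {ω | extinctionTime X ω < ∞}, v ^ totalDeaths X ω ∂μ = beta p q v := by
  have hB := abs_birthDeathRates_le hp.le hq.le hpq hb
  have h0 := ae_forall_eq_zero hX hr hP hB hm
  have hA := measurableSet_extinctionTime_lt_top hX hr
  have hroot := beta_root hp hq hpq hv1.le
  have hβ0 : 0 ≤ beta p q v := beta_nonneg hp hq hv0
  have hβ1 : beta p q v < 1 := beta_lt_one hp hq hpq hv1
  set β := beta p q v
  set s := (β + 1) / 2 with hs
  have hs0 : 0 ≤ s := by positivity
  have hs1 : s < 1 := by rw [hs]; linarith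
  have hβs : β ≤ s := by rw [hs]; linarith
  -- Convexity at the midpoint `s` of `β` and `1`: the quadratic is `0` at `β` and `-p (1 - v)` at
  -- `1`. At `β` itself there would be no decay.
  have hκ : p * v - s + q * s ^ 2 ≤ -(p * (1 - v) / 2) := by
    have : 0 ≤ q * (1 - β) ^ 2 := by positivity
    rw [hs]
    nlinarith
  have hκ0 : 0 < p * (1 - v) / 2 := div_pos (mul_pos hp (sub_pos.2 hv1)) two_pos
  set κ := p * (1 - v) / 2
  set g : ℕ → ℝ := fun j => if j = 0 then 1 else 0 with hg
  have hint : ∀ {f : ℕ → ℝ}, (∀ j, |f j| ≤ 1) → ∀ n : ℕ,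
      Integrable (fun ω => v ^ deathCount X (n + 1) ω * f (X (n + 1) ω)) μ := by
    intro f hf n
    refine Integrable.of_bound (((measurable_of_countable fun k : ℕ => v ^ k).comp
      (measurable_deathCount hX hr hl (by positivity))).mul
        ((measurable_of_countable f).comp (hX _))).aestronglyMeasurable 1 (ae_of_all _ fun ω => ?_)
    rw [norm_mul, Real.norm_of_nonneg (by positivity)]
    exact mul_le_one₀ (pow_le_one₀ hv0 hv1.le) (norm_nonneg _) (hf _)
  have hgb : ∀ j, |g j| ≤ 1 := fun j => by
    simp only [hg]
    split_ifs <;> simp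
  have hpow : ∀ {ρ : ℝ}, 0 ≤ ρ → ρ < 1 → ∀ j, |if j = 0 then (0 : ℝ) else ρ ^ j| ≤ 1 := by
    intro ρ h1 h2 j
    split_ifs
    · simp
    · rw [abs_of_nonneg (by positivity)]
      exact pow_le_one₀ h1 h2.le
  have hlim1 : Tendsto (fun n : ℕ => ∫ ω, v ^ deathCount X (n + 1) ω * g (X (n + 1) ω) ∂μ) atTop
      (𝓝 (∫ ω in {ω | extinctionTime X ω < ∞}, v ^ totalDeaths X ω ∂μ)) := by
    rw [← integral_indicator hA]
    refine tendsto_integral_of_dominated_convergence (fun _ => 1)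
      (fun n => (hint hgb n).aestronglyMeasurable) (integrable_const 1)
      (fun n => ae_of_all _ fun ω => ?_) ?_
    · rw [norm_mul, Real.norm_of_nonneg (by positivity)]
      exact mul_le_one₀ (pow_le_one₀ hv0 hv1.le) (norm_nonneg _) (hgb _)
    · filter_upwards [h0] with ω hω
      refine tendsto_nhds_of_eventually_eq ?_
      rcases eventually_deathCount_eq hr hω with ⟨h1, h2⟩ | ⟨h1, h2⟩
      · filter_upwards [h2] with n hn
        rw [indicator_of_mem h1, hn.1, hn.2]
        simp [hg]
      · refine Eventually.of_forall fun n => ?_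
        rw [indicator_of_notMem h1]
        simp [hg, h2 (n + 1)]
  -- The mean of `v ^ Y * β ^ X` is exactly `β`. Its part on `X ≠ 0` is dominated by the same part
  -- with `s ≥ β`, which decays exponentially.
  have hbound : ∀ n : ℕ, |∫ ω, v ^ deathCount X (n + 1) ω * g (X (n + 1) ω) ∂μ - β| ≤
      Real.exp (-(b * κ * ((n : ℝ) + 1))) := by
    intro n
    have hpos : (0 : ℝ≥0) < n + 1 := by positivity
    have h1 := integral_pow_deathCount_mul_pow hb hp hq hpq hX hr hl hP hm hX0 hv0 hv1.le hβ0 hβ1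
      hroot hpos
    have h2 := integral_pow_deathCount_mul_ite_le hb hp hq hpq hX hr hl hP hm hX0 hv0 hv1.le hs0
      hs1 hκ0 hκ hpos
    have h3 : ∫ ω, v ^ deathCount X (n + 1) ω * β ^ X (n + 1) ω ∂μ =
        ∫ ω, v ^ deathCount X (n + 1) ω * g (X (n + 1) ω) ∂μ +
        ∫ ω, v ^ deathCount X (n + 1) ω *
          (if X (n + 1) ω = 0 then 0 else β ^ X (n + 1) ω) ∂μ := by
      rw [← integral_add (hint hgb n) (hint (hpow hβ0 hβ1) n)]
      congr 1
      funext ω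
      rw [← mul_add]
      congr 1
      simp only [hg]
      split_ifs with h
      · simp [h]
      · simp
    have h4 : 0 ≤ ∫ ω, v ^ deathCount X (n + 1) ω *
        (if X (n + 1) ω = 0 then 0 else β ^ X (n + 1) ω) ∂μ := by
      refine integral_nonneg fun ω => mul_nonneg (by positivity) ?_
      split_ifs <;> positivity
    have h5 : ∫ ω, v ^ deathCount X (n + 1) ω *
        (if X (n + 1) ω = 0 then 0 else β ^ X (n + 1) ω) ∂μ ≤
        ∫ ω, v ^ deathCount X (n + 1) ω *
        (if X (n + 1) ω = 0 then 0 else s ^ X (n + 1) ω) ∂μ := by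
      refine integral_mono (hint (hpow hβ0 hβ1) n) (hint (hpow hs0 hs1) n) fun ω => ?_
      refine mul_le_mul_of_nonneg_left ?_ (by positivity)
      split_ifs
      · exact le_rfl
      · exact pow_le_pow_left₀ hβ0 hβs _
    push_cast at h2
    rw [abs_le]
    constructor
    · linarith
    · linarith [Real.exp_pos (-(b * κ * ((n : ℝ) + 1)))]
  refine tendsto_nhds_unique hlim1 ?_
  rw [tendsto_iff_norm_sub_tendsto_zero]
  refine squeeze_zero (fun _ => norm_nonneg _) hbound ?_
  refine Real.tendsto_exp_neg_atTop_nhds_zero.comp ?_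
  exact (tendsto_atTop_add_const_right _ 1 tendsto_natCast_atTop_atTop).const_mul_atTop
    (mul_pos hb hκ0)

theorem setIntegral_pow_totalDeaths (hb : 0 < b) (hp : 0 < p) (hq : 0 < q) (hpq : p + q = 1)
    (hX : ∀ t, Measurable (X t)) (hr : ∀ ω t, ContinuousWithinAt (fun s => X s ω) (Ici t) t)
    (hl : ∀ ω t, ∃ l, Tendsto (fun s => X s ω) (𝓝[<] t) (𝓝 l))
    (hP : IsTransitionFunction (birthDeathRates p q b) P)
    (hm : ∀ s t j, μ⟦X (s + t) ⁻¹' {j} | past X s⟧ =ᵐ[μ] fun ω => P t (X s ω) j)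
    (hX0 : ∀ᵐ ω ∂μ, X 0 ω = 1) (hv : v ∈ Icc (0 : ℝ) 1) :
    ∫ ω in {ω | extinctionTime X ω < ∞}, v ^ totalDeaths X ω ∂μ = beta p q v := by
  have h0 := ae_forall_eq_zero hX hr hP (abs_birthDeathRates_le hp.le hq.le hpq hb) hm
  have hN := (aemeasurable_totalDeaths hX hr hl h0).restrict (s := {ω | extinctionTime X ω < ∞})
  -- The rate `p (1 - v) / 2` vanishes at `v = 1`, so that endpoint is reached by continuity of both
  -- sides.
  have hcont : ContinuousOn
      (fun v : ℝ => ∫ ω in {ω | extinctionTime X ω < ∞}, v ^ totalDeaths X ω ∂μ) (Icc 0 1) := by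
    refine continuousOn_of_dominated (bound := fun _ => 1) (fun v _ => ?_) (fun v hv => ?_)
      (integrable_const 1) (ae_of_all _ fun ω => by fun_prop)
    · exact ((measurable_of_countable fun k : ℕ => v ^ k).comp_aemeasurable hN).aestronglyMeasurable
    · refine ae_of_all _ fun ω => ?_
      rw [Real.norm_of_nonneg (pow_nonneg hv.1 _)]
      exact pow_le_one₀ hv.1 hv.2
  have heq : EqOn (fun v : ℝ => ∫ ω in {ω | extinctionTime X ω < ∞}, v ^ totalDeaths X ω ∂μ)
      (beta p q) (Ico 0 1) := fun v hv =>
    setIntegral_pow_totalDeaths_of_lt_one hb hp hq hpq hX hr hl hP hm hX0 hv.1 hv.2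
  exact heq.of_subset_closure hcont (continuous_beta p q).continuousOn Ico_subset_Icc_self
    (closure_Ico zero_ne_one).ge hv

end birthDeath

end MBP

/-- For the birth-death type branching process with death rate `p * b`, birth rate `q * b` and
`X 0 = 1`: the extinction probability is `ρ = min 1 (p / q)`, the death number `Y(τ)` is finite
when `τ < ∞`, and `E[v ^ Y(τ) | τ < ∞] = β(v) / ρ` with the stated closed form and power series
of `β`. -/
theorem corollary3p3 {Ω : Type*} [MeasurableSpace Ω] (μ : Measure Ω) [IsProbabilityMeasure μ]
    (p q b : ℝ) (hb : 0 < b) (hp0 : 0 < p) (hp1 : p < 1) (hpq : p + q = 1)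
    (X : ℝ≥0 → Ω → ℕ)
    (hX : MBP.IsMarkovBranchingProcess (MBP.birthDeathRates p q b) X μ)
    (hX0 : ∀ᵐ ω ∂μ, X 0 ω = 1) :
    μ.real {ω | MBP.extinctionTime X ω < ∞} = min 1 (p / q) ∧
    (∀ ω, MBP.extinctionTime X ω < ∞ →
      MBP.deathNumber X (MBP.extinctionTime X ω) ω < ⊤) ∧
    ∀ v ∈ Icc (0 : ℝ) 1,
      Integrable (fun ω => v ^ (MBP.deathNumber X (MBP.extinctionTime X ω) ω).toNat)
        (μ[|{ω | MBP.extinctionTime X ω < ∞}]) ∧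
      ∫ ω, v ^ (MBP.deathNumber X (MBP.extinctionTime X ω) ω).toNat
          ∂(μ[|{ω | MBP.extinctionTime X ω < ∞}]) = MBP.beta p q v / min 1 (p / q) ∧
      ∃ S : ℝ,
        HasSum (fun n : ℕ => ((2 * (n + 2) - 3)‼ : ℝ) * 2 ^ (n + 2 - 1) *
          (p * q) ^ (n + 2 - 1) / ((n + 2)! : ℝ) * v ^ (n + 2)) S ∧
        MBP.beta p q v = p * (v + S) := by
  have hq : 0 < q := by linarith
  obtain ⟨-, hmeas, hr, hl, P, hP, hm⟩ := hX
  have h0 := MBP.ae_forall_eq_zero hmeas hr hP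
    (MBP.abs_birthDeathRates_le hp0.le hq.le hpq hb) hm
  have hA := MBP.measurableSet_extinctionTime_lt_top hmeas hr
  have hgf := fun (v : ℝ) (hv : v ∈ Icc (0 : ℝ) 1) =>
    MBP.setIntegral_pow_totalDeaths hb hp0 hq hpq hmeas hr hl hP hm hX0 hv
  have hμA : μ.real {ω | MBP.extinctionTime X ω < ∞} = min 1 (p / q) := by
    -- At `v = 1` the integrand is `1`, so the generating function is the extinction probability.
    have h1 := hgf 1 (right_mem_Icc.2 zero_le_one)
    rw [MBP.beta_one hq hpq] at h1
    simpa using h1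
  refine ⟨hμA, fun ω hω => MBP.deathNumber_extinctionTime_lt_top (hr ω) (hl ω) hω,
    fun v hv => ⟨?_, ?_, MBP.exists_hasSum_beta hp0 hq hpq hv.1 hv.2⟩⟩
  · have hae : (fun ω => v ^ MBP.totalDeaths X ω) =ᵐ[μ[|{ω | MBP.extinctionTime X ω < ∞}]]
        fun ω => v ^ (MBP.deathNumber X (MBP.extinctionTime X ω) ω).toNat := by
      filter_upwards [ae_cond_mem hA] with ω hω
      rw [MBP.totalDeaths_of_lt_top hω]
    refine Integrable.congr (Integrable.of_bound ?_ 1 (ae_of_all _ fun ω => ?_)) hae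
    · exact ((measurable_of_countable fun k : ℕ => v ^ k).comp_aemeasurable
        ((MBP.aemeasurable_totalDeaths hmeas hr hl h0).mono_ac
          (cond_absolutelyContinuous))).aestronglyMeasurable
    · rw [Real.norm_of_nonneg (pow_nonneg hv.1 _)]
      exact pow_le_one₀ hv.1 hv.2
  · have h1 : ∫ ω in {ω | MBP.extinctionTime X ω < ∞},
        v ^ (MBP.deathNumber X (MBP.extinctionTime X ω) ω).toNat ∂μ = MBP.beta p q v := by
      rw [← hgf v hv]
      refine setIntegral_congr_fun hA fun ω hω => ?_
      simp only [MBP.totalDeaths_of_lt_top hω]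
    rw [ProbabilityTheory.cond, integral_smul_measure, h1, ENNReal.toReal_inv, ← hμA,
      smul_eq_mul, div_eq_inv_mul]
    rfl
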